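/- Let $n\ge 1$ and $K\ge 2$ be integers (in particular any $K>2n$ is allowed) and $k=\lceil \lg K\rceil$. Processors $p_0,\dots,p_{n-1}$ form a unidirectional ring. Each $p_i$ owns $k$ pairs of single-bit safe registers $(\mathsf R_a[j],\mathsf R_b[j])$, $0\le j<k$, which only $p_i$ writes and which $p_i$ and its successor $p_{i+1 \bmod n}$ read; index $j=0$ is the most significant bit (MSB). Register operations have an invocation and a response; a read that overlaps no write to the same register returns the last written value, and a read that overlaps a write returns an arbitrary bit. Let $\mathrm{gray}_k$ be the $k$-bit reflected Gray code. Each $p_i$ has local variables $X\in\{0,1\}^k$, $Y\in\{0,1,\perp\}^k$, $x\in\{0,\dots,K-1\}$, $y\in\{0,\dots,K-1,\perp\}$ and repeats forever: 1. for $j=0,\dots,k-1$, read its own $\mathsf R_a[j]$ into $X[j]$; then $x\leftarrow \mathrm{gray}_k^{-1}(X)\bmod K$; 2. for $j=0,\dots,k-1$, read the predecessor's registers in the order $\mathsf R_a[j],\mathsf R_b[j],\mathsf R_a[j],\mathsf R_b[j]$, and let $Y[j]$ be the common value of the four readings if they agree and $\perp$ otherwise; then $y\leftarrow \mathrm{gray}_k^{-1}(Y)\bmod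 K$, where $y=\perp$ if some $Y[j]=\perp$; 3. if $y\ne\perp$, $i\neq 0$ and $x\neq y$, then $x\leftarrow y$ and execute the critical section; if $y\ne\perp$, $i=0$ and $x=y$, then $x\leftarrow (x+1)\bmod K$ and execute the critical section; 4. $X\leftarrow \mathrm{gray}_k(x)$; for $j=k-1,\dots,0$, read its own $\mathsf R_a[j]$ and $\mathsf R_b[j]$ and, unless both equal $X[j]$, write $X[j]$ to $\mathsf R_a[j]$ and then to $\mathsf R_b[j]$. A state consists of the contents of all registers and, for every processor, its control location (including register operations in progress) and its variables. An execution is an infinite interleaving of the processors' steps, from an arbitrary initial state, in which every processor takes infinitely many steps. In a state, a register to which a write is in progress is taken to have the value being written; $x$ and $y$ contribute the bits of their Gray codes; $\perp$ is not a bit value. A *flash state* is one in which all values of the MSB are zero, in every register and in every internal variable of every processor (including the readings stored so far by a read or write procedure in progress). A *home state* is one in which, for every bit position, all values of that bit in the registers and in the variables $X,Y,x,y$ of all processors are equal (different positions may have different values). Then every execution that starts from a flash state contains a home state. -/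

import Mathlib

namespace GrayRing

/-! ### Reflected Gray code -/

/-- The constant `k = ⌈lg K⌉`, the number of bit positions. -/
abbrev width (K : ℕ) : ℕ := Nat.clog 2 K

/-- The `k`-bit reflected Gray code of `v`; index `0` is the most significant bit. -/
def gray (k v : ℕ) (j : Fin k) : Bool :=
  (v ^^^ (v >>> 1)).testBit (k - 1 - j.val)

/-- Decoding of the `k`-bit reflected Gray code: bit `j` of the binary representation is the
parity of the Gray bits at positions `0, …, j`. -/
def grayInv (k : ℕ) (g : Fin k → Bool) : ℕ :=
  ∑ j : Fin k,
    if (Finset.univ.filter fun l : Fin k => l ≤ j ∧ g l = true).card % 2 = 1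
    then 2 ^ (k - 1 - j.val) else 0

/-! ### Processors and states -/

/-- The two registers of the pair kept for every bit position. -/
inductive Half where
  | a : Half
  | b : Half
deriving DecidableEq

/-- The register read by the `m`-th low-level read of the two-scan read: `a`, `b`, `a`, `b`. -/
def halfOf (m : Fin 4) : Half := if m.val % 2 = 0 then Half.a else Half.b

/-- Control locations of a processor. The local variables of the read and write procedures
live in the corresponding locations. -/
inductive PC (k : ℕ) where
  /-- head of the loop that reads the own registers `R_a[j]` into `X[j]`, `j = 0, …, k-1` -/
  | loopX (j : Fin (k + 1)) : PC k
  /-- about to assign `x ← gray⁻¹(X) mod K` -/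
  | decodeX : PC k
  /-- head of the loop that reads the predecessor's bit `j` into `Y[j]`, `j = 0, …, k-1` -/
  | loopY (j : Fin (k + 1)) : PC k
  /-- inside the two-scan read of bit `j`: the first `m` readings are in `buf 0, …, buf (m-1)`
  (in the order `A[1], B[1], A[2], B[2]`). With `none` the `m`-th low-level read has not been
  invoked; with `some t` it has been invoked and has not responded, and `t` records whether a
  write to that register has been completed since its invocation. -/
  | aread (j : Fin k) (m : Fin 4) (buf : Fin 4 → Bool) (pending : Option Bool) : PC k
  /-- about to assign `y ← gray⁻¹(Y) mod K` -/
  | decodeY : PC k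
  /-- about to compare `x` and `y` -/
  | test : PC k
  /-- in the critical section -/
  | critical : PC k
  /-- about to assign `X ← gray(x)` -/
  | encode : PC k
  /-- head of the writing loop, with the bits `r-1, …, 0` (in this order) still to be written -/
  | loopW (r : Fin (k + 1)) : PC k
  /-- write procedure for bit `j`: about to read the own `R_a[j]` into `A` -/
  | writeA (j : Fin k) : PC k
  /-- write procedure for bit `j`: about to read the own `R_b[j]` into `B` -/
  | writeB (j : Fin k) (A : Bool) : PC k
  /-- write procedure for bit `j`: about to test `A = B = X[j]` -/
  | writeTest (j : Fin k) (A B : Bool) : PC k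
  /-- about to invoke the low-level write of `X[j]` to register `c` of pair `j` -/
  | invoke (c : Half) (j : Fin k) : PC k
  /-- the low-level write of `X[j]` to register `c` of pair `j` is in progress -/
  | writing (c : Half) (j : Fin k) : PC k

/-- A processor together with its output registers. The value `⊥` is `none`. -/
structure Node (K : ℕ) where
  pc : PC (width K)
  X : Fin (width K) → Bool
  Y : Fin (width K) → Option Bool
  x : Fin K
  y : Option (Fin K)
  /-- the value last completely written to the register -/
  R : Half → Fin (width K) → Bool

/-- A (global) state of the ring `p_0, …, p_{n-1}`. -/
abbrev Config (n K : ℕ) : Type := Fin n → Node K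

/-- Is a low-level write to register `c` of pair `j` in progress? -/
def Node.busy {K : ℕ} (p : Node K) (c : Half) (j : Fin (width K)) : Bool :=
  match p.pc with
  | PC.writing c' j' => decide (c' = c ∧ j' = j)
  | _ => false

/-- The value attributed to a register in a state: the value being written if a write is in
progress, and the last written value otherwise. -/
def Node.regVal {K : ℕ} (p : Node K) (c : Half) (j : Fin (width K)) : Bool :=
  if p.busy c j then p.X j else p.R c j

/-- Record, in a pending read of register `c` of the predecessor's pair `j`, that a write to
this register has just been completed. -/
def Node.overlap {K : ℕ} (p : Node K) (c : Half) (j : Fin (width K)) : Node K :=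
  match p.pc with
  | PC.aread j' m buf (some t) =>
      { p with pc := PC.aread j' m buf (some (t || decide (j' = j ∧ halfOf m = c))) }
  | _ => p

/-! ### The protocol -/

/-- The result of the two-scan read from its four readings. -/
def unanimous (buf : Fin 4 → Bool) : Option Bool :=
  if ∀ m, buf m = buf 0 then some (buf 0) else none

/-- `gray⁻¹(Y) mod K`, which is `⊥` if some entry is `⊥`. -/
def decodeRead (K : ℕ) [NeZero K] (Y : Fin (width K) → Option Bool) : Option (Fin K) :=
  if ∀ j, Y j ≠ none then
    some (Fin.ofNat K (grayInv (width K) fun j => (Y j).getD false))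
  else none

/-- One step of processor `p_i`. The registers are safe: the response of a low-level read that
overlaps a write to the same register is arbitrary, namely `coin`. A write overlaps a read
exactly if it is completed during the read or is in progress at the response of the read.
(Processors read their own registers in one step, since no other processor writes them.) -/
def step {n K : ℕ} [NeZero n] [NeZero K] (i : Fin n) (coin : Bool) (s : Config n K) :
    Config n K :=
  let p := s i
  let q := s (i - 1)
  match p.pc with
  | PC.loopX j =>
      if h : j.val < width K then
        Function.update s i
          { p with X := Function.update p.X ⟨j.val, h⟩ (p.R Half.a ⟨j.val, h⟩),
                   pc := PC.loopX ⟨j.val + 1, by omega⟩ }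
      else Function.update s i { p with pc := PC.decodeX }
  | PC.decodeX =>
      Function.update s i
        { p with x := Fin.ofNat K (grayInv (width K) p.X), pc := PC.loopY 0 }
  | PC.loopY j =>
      if h : j.val < width K then
        Function.update s i { p with pc := PC.aread ⟨j.val, h⟩ 0 (fun _ => false) none }
      else Function.update s i { p with pc := PC.decodeY }
  | PC.aread j m buf none =>
      Function.update s i { p with pc := PC.aread j m buf (some false) }
  | PC.aread j m buf (some t) =>
      let v := if t || q.busy (halfOf m) j then coin else q.R (halfOf m) j
      let buf' := Function.update buf m v
      if h : m.val + 1 < 4 then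
        Function.update s i { p with pc := PC.aread j ⟨m.val + 1, h⟩ buf' none }
      else
        Function.update s i
          { p with Y := Function.update p.Y j (unanimous buf'), pc := PC.loopY j.succ }
  | PC.decodeY =>
      Function.update s i { p with y := decodeRead K p.Y, pc := PC.test }
  | PC.test =>
      match p.y with
      | none => Function.update s i { p with pc := PC.encode }
      | some z =>
          if i ≠ 0 ∧ p.x ≠ z then
            Function.update s i { p with x := z, pc := PC.critical }
          else if i = 0 ∧ z = p.x then
            Function.update s i { p with x := Fin.ofNat K (p.x.val + 1), pc := PC.critical }
          else Function.update s i { p with pc := PC.encode }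
  | PC.critical => Function.update s i { p with pc := PC.encode }
  | PC.encode =>
      Function.update s i
        { p with X := gray (width K) p.x.val, pc := PC.loopW (Fin.last (width K)) }
  | PC.loopW r =>
      if h : 0 < r.val then
        Function.update s i { p with pc := PC.writeA ⟨r.val - 1, by omega⟩ }
      else Function.update s i { p with pc := PC.loopX 0 }
  | PC.writeA j => Function.update s i { p with pc := PC.writeB j (p.R Half.a j) }
  | PC.writeB j A => Function.update s i { p with pc := PC.writeTest j A (p.R Half.b j) }
  | PC.writeTest j A B =>
      if A = p.X j ∧ B = p.X j then Function.update s i { p with pc := PC.loopW j.castSucc }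
      else Function.update s i { p with pc := PC.invoke Half.a j }
  | PC.invoke c j => Function.update s i { p with pc := PC.writing c j }
  | PC.writing c j =>
      let p' : Node K :=
        { p with R := Function.update p.R c (Function.update (p.R c) j (p.X j)),
                 pc := match c with
                   | Half.a => PC.invoke Half.b j
                   | Half.b => PC.loopW j.castSucc }
      let s' := Function.update s i p'
      Function.update s' (i + 1) ((s' (i + 1)).overlap c j)

/-- Executions: infinite interleavings of processor steps, in which every processor takes
infinitely many steps and reads overlapping writes respond arbitrarily. -/
def IsExecution {n K : ℕ} [NeZero n] [NeZero K] (σ : ℕ → Config n K) : Prop :=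
  ∃ (sched : ℕ → Fin n) (coin : ℕ → Bool),
    (∀ t, σ (t + 1) = step (sched t) (coin t) (σ t)) ∧
    ∀ i : Fin n, ∃ᶠ t in Filter.atTop, sched t = i

/-! ### Flash states and home states -/

/-- The bit value `v` occurs at position `j` in an output register or in one of the variables
`X`, `Y`, `x`, `y` of the processor (where `x` and `y` are taken in Gray code, and `⊥` is not a
bit value). -/
def Node.Holds {K : ℕ} (p : Node K) (j : Fin (width K)) (v : Bool) : Prop :=
  (∃ c, p.regVal c j = v) ∨ p.X j = v ∨ p.Y j = some v ∨
    gray (width K) p.x.val j = v ∨ ∃ z, p.y = some z ∧ gray (width K) z.val j = v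

/-- The bit value `v` has been read at position `j` into a local variable of a read or write
procedure that is being executed. -/
def PC.Holds {k : ℕ} (pc : PC k) (j : Fin k) (v : Bool) : Prop :=
  match pc with
  | PC.aread j' m buf _ => j' = j ∧ ∃ l, l < m ∧ buf l = v
  | PC.writeB j' A => j' = j ∧ A = v
  | PC.writeTest j' A B => j' = j ∧ (A = v ∨ B = v)
  | _ => False

/-- Flash state: all values of the most significant bit are zero, in every register and in every
internal variable of every processor. -/
def IsFlash {n K : ℕ} (s : Config n K) : Prop :=
  ∀ (i : Fin n) (j : Fin (width K)), j.val = 0 →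
    ¬ (s i).Holds j true ∧ ¬ (s i).pc.Holds j true

/-- Home state: for every bit position, all values of this bit in the registers and in the
corresponding variables of all processors are equal. -/
def IsHome {n K : ℕ} (s : Config n K) : Prop :=
  ∀ j : Fin (width K), ∃ v : Bool, ∀ (i : Fin n) (w : Bool), (s i).Holds j w → w = v

end GrayRing

/-! Let `v = 2 ^ (k - 1)`, the least value whose Gray code has MSB one; `v < K` because `k = ⌈lg
K⌉`. From a flash state, the first time `p_0` stands at its test with `x = y = v` (`Fires`) is a
home state.

Such a time exists, whatever the initial state. If `p_0` never incremented its value, its registers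
would settle at that value, then those of its successor, and so on around the ring, until `p_0` read
its own value back and had to increment (`eventually_increments`). So `p_0` increments from every
residue (`exists_increment_from`).

Before that time, misread lower bits may create any value below `v`, but an MSB equal to one
originates only in `p_0` incrementing `v - 1`. A processor writes the MSB last, and its second
register at the very end, whereas a reader starts with the MSB. The crux (`Scan`) is that the
readings a, b, a, b of the MSB are all one only if the predecessor has begun to raise the second
register. By then the other bits are those of `v` and stable, so the rest of the read yields exactly
`v`. Hence a processor other than `p_0` adopts `v` only from a predecessor that shows `v` everywhere
(`High`), and later reads can only return `v` or `⊥`. When `p_0` reads `v`, its predecessor is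
`High`, and going backwards along the ring so is everybody (`all_high`). The invariant `Inv`,
preserved by `inv_step`, records this. -/

namespace GrayRing

/-! ### Arithmetic of the reflected Gray code -/

theorem card_gray_prefix_odd (k v : ℕ) (hv : v < 2 ^ k) (m : ℕ) (hm : m ≤ k) :
    (Finset.univ.filter fun l : Fin k => l.val < m ∧ gray k v l = true).card % 2
      = (v.testBit (k - m)).toNat := by
  induction m with
  | zero => simp [Nat.testBit_lt_two_pow hv]
  | succ m ih =>
    have ih := ih (by omega)
    have hk : k - 1 - m = k - (m + 1) := by omega
    have hk' : 1 + (k - (m + 1)) = k - m := by omega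
    -- Each Gray bit is the XOR of two adjacent binary bits, so the prefix parities telescope; the
    -- bit above the top one is zero since `v < 2 ^ k`.
    have hg : gray k v ⟨m, hm⟩ = (v.testBit (k - (m + 1)) ^^ v.testBit (k - m)) := by
      simp [gray, Nat.testBit_xor, Nat.testBit_shiftRight, hk, hk']
    by_cases h : gray k v ⟨m, hm⟩ = true
    · have : (Finset.univ.filter fun l : Fin k => l.val < m + 1 ∧ gray k v l = true)
          = insert ⟨m, hm⟩ (Finset.univ.filter fun l : Fin k => l.val < m ∧ gray k v l = true) := by
        ext l
        simp only [Finset.mem_filter, Finset.mem_univ, true_and, Finset.mem_insert]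
        constructor
        · rintro ⟨h1, h2⟩
          by_cases hl : l.val = m
          · left; exact Fin.ext hl
          · right; exact ⟨by omega, h2⟩
        · rintro (rfl | ⟨h1, h2⟩)
          · exact ⟨by simp, h⟩
          · exact ⟨by omega, h2⟩
      rw [this, Finset.card_insert_of_notMem (by simp), Nat.add_mod, ih]
      rw [hg] at h
      revert h
      cases v.testBit (k - (m + 1)) <;> cases v.testBit (k - m) <;> simp
    · have : (Finset.univ.filter fun l : Fin k => l.val < m + 1 ∧ gray k v l = true)
          = (Finset.univ.filter fun l : Fin k => l.val < m ∧ gray k v l = true) := by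
        ext l
        simp only [Finset.mem_filter, Finset.mem_univ, true_and]
        constructor
        · rintro ⟨h1, h2⟩
          refine ⟨?_, h2⟩
          by_contra hl
          have : l = ⟨m, hm⟩ := Fin.ext (by simp; omega)
          exact h (this ▸ h2)
        · rintro ⟨h1, h2⟩
          exact ⟨by omega, h2⟩
      rw [this, ih]
      rw [hg] at h
      revert h
      cases v.testBit (k - (m + 1)) <;> cases v.testBit (k - m) <;> simp

theorem sum_testBit_two_pow (v k : ℕ) :
    ∑ i ∈ Finset.range k, (if v.testBit i = true then 2 ^ i else 0) = v % 2 ^ k := by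
  induction k with
  | zero => simp [Nat.mod_one]
  | succ k ih =>
    rw [Finset.sum_range_succ, ih, Nat.mod_pow_succ, Nat.testBit_eq_decide_div_mod_eq]
    rcases Nat.mod_two_eq_zero_or_one (v / 2 ^ k) with h | h <;> simp [h]

theorem grayInv_gray (k v : ℕ) (hv : v < 2 ^ k) : grayInv k (gray k v) = v := by
  have h1 : grayInv k (gray k v)
      = ∑ j : Fin k, (if v.testBit (k - 1 - j.val) = true then 2 ^ (k - 1 - j.val) else 0) := by
    refine Finset.sum_congr rfl fun j _ => ?_
    have := card_gray_prefix_odd k v hv (j.val + 1) j.isLt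
    have hk : k - (j.val + 1) = k - 1 - j.val := by omega
    rw [hk] at this
    simp only [Nat.lt_succ_iff] at this
    simp only [Fin.le_def, this]
    cases v.testBit (k - 1 - j.val) <;> simp
  rw [h1, Fin.sum_univ_eq_sum_range
    (fun j => if v.testBit (k - 1 - j) = true then 2 ^ (k - 1 - j) else 0),
    Finset.sum_range_reflect (fun i => if v.testBit i = true then 2 ^ i else 0),
    sum_testBit_two_pow, Nat.mod_eq_of_lt hv]

/-- The leading binary digit is the MSB itself, and the remaining digits sum to less than `2 ^ (k -
1)`. As `g` is arbitrary, this also covers mixtures of stale and misread bits. -/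
theorem grayInv_lt_of_msb (k : ℕ) (g : Fin k → Bool) (z : Fin k) (hz : z.val = 0)
    (hg : g z = false) : grayInv k g < 2 ^ (k - 1) := by
  obtain _ | m := k
  · exact z.elim0
  obtain rfl : z = 0 := Fin.ext hz
  unfold grayInv
  rw [Fin.sum_univ_succ, if_neg, zero_add]
  · have hle : ∀ j : Fin m, (if (Finset.univ.filter fun l : Fin (m + 1) =>
        l ≤ j.succ ∧ g l = true).card % 2 = 1 then 2 ^ (m + 1 - 1 - j.succ.val) else 0)
          ≤ 2 ^ (m - 1 - j.val) := by
      intro j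
      have : m + 1 - 1 - j.succ.val = m - 1 - j.val := by simp; omega
      rw [this]
      split_ifs <;> simp
    refine (Finset.sum_le_sum fun j _ => hle j).trans_lt ?_
    rw [Fin.sum_univ_eq_sum_range (fun j => 2 ^ (m - 1 - j)),
      Finset.sum_range_reflect (fun i => 2 ^ i), Nat.geomSum_eq le_rfl]
    have := Nat.two_pow_pos m
    simp
  · have : (Finset.univ.filter fun l : Fin (m + 1) => l ≤ 0 ∧ g l = true) = ∅ := by
      ext l
      simp only [Finset.mem_filter, Finset.mem_univ, true_and, Finset.notMem_empty, iff_false,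
        not_and]
      intro h
      obtain rfl : l = 0 := Fin.le_zero_iff.mp h
      simp [hg]
    change ¬ (Finset.univ.filter fun l : Fin (m + 1) => l ≤ 0 ∧ g l = true).card % 2 = 1
    rw [this]
    simp

theorem gray_msb_eq_false {k v : ℕ} (z : Fin k) (hz : z.val = 0) (hv : v < 2 ^ (k - 1)) :
    gray k v z = false := by
  have h1 : v < 2 ^ (1 + (k - 1)) := hv.trans_le (Nat.pow_le_pow_right (by simp) (by omega))
  simp [gray, hz, Nat.testBit_xor, Nat.testBit_shiftRight, Nat.testBit_lt_two_pow hv,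
    Nat.testBit_lt_two_pow h1]

theorem gray_msb_two_pow {k : ℕ} (z : Fin k) (hz : z.val = 0) :
    gray k (2 ^ (k - 1)) z = true := by
  have h1 : (2 ^ (k - 1)).testBit (1 + (k - 1)) = false := by
    rw [Nat.testBit_two_pow]; simp
  simp [gray, hz, Nat.testBit_xor, Nat.testBit_shiftRight, Nat.testBit_two_pow_self, h1]

theorem width_pos {K : ℕ} (hK : 2 ≤ K) : 0 < width K := Nat.clog_pos (by norm_num) hK

theorem lt_two_pow_width {K : ℕ} (x : Fin K) : x.val < 2 ^ width K :=
  x.isLt.trans_le (Nat.le_pow_clog (by norm_num) K)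

theorem two_pow_width_pred_lt {K : ℕ} (hK : 2 ≤ K) : 2 ^ (width K - 1) < K :=
  Nat.pow_pred_clog_lt_self (by norm_num) (by omega)

theorem ofNat_grayInv_gray {K : ℕ} [NeZero K] (x : Fin K) :
    Fin.ofNat K (grayInv (width K) (gray (width K) x.val)) = x := by
  rw [grayInv_gray _ _ (lt_two_pow_width x)]
  simp

theorem decodeRead_gray {K : ℕ} [NeZero K] (x : Fin K) (Y : Fin (width K) → Option Bool)
    (hY : ∀ j, Y j = some (gray (width K) x.val j)) : decodeRead K Y = some x := by
  have h := ofNat_grayInv_gray x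
  simp only [decodeRead, hY, ne_eq, reduceCtorEq, not_false_eq_true, implies_true, if_true,
    Option.getD_some]
  exact congrArg some h

/-! ### Steps seen from a single processor -/

section Local
variable {K : ℕ}

/-- The effect on a processor `p` of a step of its predecessor `q`. -/
def hear (q p : Node K) : Node K :=
  match q.pc with
  | PC.writing c j => p.overlap c j
  | _ => p

theorem overlap_eq_self {p : Node K} (c : Half) (j : Fin (width K))
    (h : ∀ j m buf t, p.pc ≠ PC.aread j m buf (some t)) : p.overlap c j = p := by
  unfold Node.overlap
  split
  · rename_i h'; exact absurd h' (h _ _ _ _)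
  · rfl

variable [NeZero K]

/-- The effect of a step on the processor that makes it; `first` says whether it is `p_0`, and
`q` is the predecessor. -/
def own (first coin : Bool) (q p : Node K) : Node K :=
  match p.pc with
  | PC.loopX j =>
      if h : j.val < width K then
        { p with X := Function.update p.X ⟨j.val, h⟩ (p.R Half.a ⟨j.val, h⟩),
                 pc := PC.loopX ⟨j.val + 1, by omega⟩ }
      else { p with pc := PC.decodeX }
  | PC.decodeX => { p with x := Fin.ofNat K (grayInv (width K) p.X), pc := PC.loopY 0 }
  | PC.loopY j =>
      if h : j.val < width K then { p with pc := PC.aread ⟨j.val, h⟩ 0 (fun _ => false) none }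
      else { p with pc := PC.decodeY }
  | PC.aread j m buf none => { p with pc := PC.aread j m buf (some false) }
  | PC.aread j m buf (some t) =>
      let v := if t || q.busy (halfOf m) j then coin else q.R (halfOf m) j
      let buf' := Function.update buf m v
      if h : m.val + 1 < 4 then { p with pc := PC.aread j ⟨m.val + 1, h⟩ buf' none }
      else { p with Y := Function.update p.Y j (unanimous buf'), pc := PC.loopY j.succ }
  | PC.decodeY => { p with y := decodeRead K p.Y, pc := PC.test }
  | PC.test =>
      match p.y with
      | none => { p with pc := PC.encode }
      | some z =>
          if first = false ∧ p.x ≠ z then { p with x := z, pc := PC.critical }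
          else if first = true ∧ z = p.x then
            { p with x := Fin.ofNat K (p.x.val + 1), pc := PC.critical }
          else { p with pc := PC.encode }
  | PC.critical => { p with pc := PC.encode }
  | PC.encode => { p with X := gray (width K) p.x.val, pc := PC.loopW (Fin.last (width K)) }
  | PC.loopW r =>
      if h : 0 < r.val then { p with pc := PC.writeA ⟨r.val - 1, by omega⟩ }
      else { p with pc := PC.loopX 0 }
  | PC.writeA j => { p with pc := PC.writeB j (p.R Half.a j) }
  | PC.writeB j A => { p with pc := PC.writeTest j A (p.R Half.b j) }
  | PC.writeTest j A B =>
      if A = p.X j ∧ B = p.X j then { p with pc := PC.loopW j.castSucc }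
      else { p with pc := PC.invoke Half.a j }
  | PC.invoke c j => { p with pc := PC.writing c j }
  | PC.writing c j =>
      { p with R := Function.update p.R c (Function.update (p.R c) j (p.X j)),
               pc := match c with
                 | Half.a => PC.invoke Half.b j
                 | Half.b => PC.loopW j.castSucc }

variable {n : ℕ} [NeZero n]

/-- Needed for the ring with one processor, which is its own predecessor: completing a write leaves
no read pending that could overlap it. -/
theorem hear_own_self (first coin : Bool) (p : Node K) :
    hear p (own first coin p p) = own first coin p p := by
  unfold hear
  split
  · rename_i c j h
    apply overlap_eq_self
    intro j m buf t
    simp only [own, h]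
    cases c <;> simp
  · rfl

theorem step_apply_self (i : Fin n) (coin : Bool) (s : Config n K) :
    step i coin s i = own (decide (i = 0)) coin (s (i - 1)) (s i) := by
  have hov : ∀ (c : Half) (j : Fin (width K)) (p : Node K),
      (∀ j m buf t, p.pc ≠ PC.aread j m buf (some t)) →
      Function.update (Function.update s i p) (i + 1)
        ((Function.update s i p (i + 1)).overlap c j) i = p := by
    intro c j p hp
    -- Equality occurs exactly in a ring with one processor.
    by_cases h : i = i + 1
    · rw [← h]; simp [overlap_eq_self c j hp]
    · rw [Function.update_of_ne h, Function.update_self]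
  unfold step own
  generalize hpc : (s i).pc = pc
  cases pc with
  | aread j m buf t => cases t <;> simp; split <;> simp
  | test =>
    cases hy : (s i).y
    · simp
    · simp; split_ifs <;> simp_all
  | writing c j =>
    simp only []
    cases c <;> exact hov _ j _ (by intros; simp)
  | loopX j => simp only []; split_ifs <;> simp
  | loopY j => simp only []; split_ifs <;> simp
  | loopW j => simp only []; split_ifs <;> simp
  | writeTest j => simp only []; split_ifs <;> simp
  | _ => simp

theorem step_apply_of_ne {i j : Fin n} (hij : j ≠ i) (coin : Bool) (s : Config n K) :
    step i coin s j = if j = i + 1 then hear (s i) (s j) else s j := by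
  unfold step hear
  generalize hpc : (s i).pc = pc
  cases pc with
  | aread j m buf t => cases t <;> simp [hij]; split <;> simp [hij]
  | test => cases hy : (s i).y <;> simp [hij]; split_ifs <;> simp [hij]
  | writing c l =>
    simp only []
    by_cases h : j = i + 1
    · subst h; simp [hij]
    · simp [h, hij]
  | loopX l => simp only []; split_ifs <;> simp [hij]
  | loopY l => simp only []; split_ifs <;> simp [hij]
  | loopW l => simp only []; split_ifs <;> simp [hij]
  | writeTest l => simp only []; split_ifs <;> simp [hij]
  | _ => simp [hij]

end Local

/-! ### Carrying, settling at and reading a value -/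

section Predicates
variable {K : ℕ}

/-- The processor carries the value `v`: `x = v`, and the registers treated so far by the writing
loop (all of them outside of the loop) contain the Gray code of `v`. -/
def Carries (v : Fin K) (p : Node K) : Prop :=
  p.x = v ∧
  match p.pc with
  | PC.critical => True
  | PC.encode => True
  | PC.loopW r => p.X = gray _ v.val ∧ ∀ c l, r.val ≤ l.val → p.R c l = gray _ v.val l
  | PC.writeA j => p.X = gray _ v.val ∧ ∀ c l, j < l → p.R c l = gray _ v.val l
  | PC.writeB j A =>
      (p.X = gray _ v.val ∧ ∀ c l, j < l → p.R c l = gray _ v.val l) ∧ A = p.R Half.a j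
  | PC.writeTest j A B =>
      (p.X = gray _ v.val ∧ ∀ c l, j < l → p.R c l = gray _ v.val l) ∧
        A = p.R Half.a j ∧ B = p.R Half.b j
  | PC.invoke c j =>
      (p.X = gray _ v.val ∧ ∀ c l, j < l → p.R c l = gray _ v.val l) ∧
        (c = Half.b → p.R Half.a j = gray _ v.val j)
  | PC.writing c j =>
      (p.X = gray _ v.val ∧ ∀ c l, j < l → p.R c l = gray _ v.val l) ∧
        (c = Half.b → p.R Half.a j = gray _ v.val j)
  | _ => p.X = gray _ v.val ∧ ∀ c l, p.R c l = gray _ v.val l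

/-- The processor carries `v` in `x`, `X` and all its registers, and is not about to write. -/
def Settled (v : Fin K) (p : Node K) : Prop :=
  (p.x = v ∧ p.X = gray _ v.val ∧ ∀ c l, p.R c l = gray _ v.val l) ∧
  match p.pc with
  | PC.critical => False
  | PC.writeB j A => A = gray _ v.val j
  | PC.writeTest j A B => A = gray _ v.val j ∧ B = gray _ v.val j
  | PC.invoke _ _ => False
  | PC.writing _ _ => False
  | _ => True

/-- All that has been read from the predecessor in the current round agrees with the Gray code
of `v`. -/
def ReadsOnly (v : Fin K) (p : Node K) : Prop :=
  match p.pc with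
  | PC.loopY j => ∀ l : Fin (width K), l.val < j.val → p.Y l = some (gray _ v.val l)
  | PC.aread j m buf t =>
      (∀ l : Fin (width K), l < j → p.Y l = some (gray _ v.val l)) ∧
      (∀ l, l < m → buf l = gray _ v.val j) ∧ t ≠ some true
  | PC.decodeY => ∀ l : Fin (width K), p.Y l = some (gray _ v.val l)
  | PC.test => (∀ l : Fin (width K), p.Y l = some (gray _ v.val l)) ∧ p.y = some v
  | _ => True

/-- At the test, the processor will not change its value `v`. -/
def Calm (first : Bool) (v : Fin K) (p : Node K) : Prop :=
  p.pc = PC.test → if first = true then p.y ≠ some v else (p.y = none ∨ p.y = some v)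

theorem Settled.carries {v : Fin K} {p : Node K} (h : Settled v p) : Carries v p := by
  obtain ⟨pc, X, Y, x, y, R⟩ := p
  obtain ⟨⟨h1, h2, h3⟩, h4⟩ := h
  cases pc <;> simp_all [Carries]

theorem Carries.settled_of_loopX_zero {v : Fin K} {p : Node K} (h : Carries v p)
    (hp : p.pc = PC.loopX 0) : Settled v p := by
  obtain ⟨pc, X, Y, x, y, R⟩ := p
  subst hp
  simp_all [Settled, Carries]

theorem unanimous_eq_some {buf : Fin 4 → Bool} {a : Bool} :
    unanimous buf = some a ↔ ∀ m, buf m = a := by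
  unfold unanimous
  split_ifs with h
  · simp only [Option.some.injEq]
    exact ⟨fun h' m => (h m).trans h', fun h' => h' 0⟩
  · simp only [false_iff]
    exact fun h' => h fun m => (h' m).trans (h' 0).symm

variable [NeZero K]

/-- The writing loop extends the set of correct registers by one bit per turn, skipping a bit only
when both registers are already correct; decoding `X = gray v` gives back `v`. So only the test
could change the value, and `Calm` excludes that. -/
theorem Carries.own {first coin : Bool} {v : Fin K} {q p : Node K} (h : Carries v p)
    (hc : Calm first v p) : Carries v (own first coin q p) := by
  obtain ⟨pc, X, Y, x, y, R⟩ := p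
  obtain ⟨hx, h⟩ := h
  dsimp only at hx
  subst hx
  cases pc with
  | loopX j =>
    dsimp only at h
    obtain ⟨rfl, h2⟩ := h
    simp only [GrayRing.own]
    split_ifs
    · simp [Carries, h2]
    · simp [Carries, h2]
  | decodeX =>
    dsimp only at h
    obtain ⟨rfl, h2⟩ := h
    simp only [GrayRing.own, ofNat_grayInv_gray]
    simp [Carries, h2]
  | loopY j => simp only [GrayRing.own]; split_ifs <;> simpa [Carries] using h
  | aread j m buf t =>
    cases t
    · simpa [GrayRing.own, Carries] using h
    · simp only [GrayRing.own]; split_ifs <;> simpa [Carries] using h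
  | decodeY => simpa [GrayRing.own, Carries] using h
  | test =>
    have hc := hc rfl
    cases y with
    | none => simp [GrayRing.own, Carries]
    | some z => cases first <;> simp_all [GrayRing.own, Carries]
  | critical => simp [GrayRing.own, Carries]
  | encode =>
    simp only [GrayRing.own, Carries, Fin.val_last, true_and]
    intro c l hl
    exact absurd l.isLt (by omega)
  | loopW r =>
    simp only [GrayRing.own]
    split_ifs with h0
    · simp only [Carries, true_and]
      refine ⟨h.1, fun c l hl => h.2 c l ?_⟩
      have : r.val - 1 < l.val := hl
      omega
    · simp only [Carries, true_and]
      exact ⟨h.1, fun c l => h.2 c l (by omega)⟩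
  | writeA j => simpa [GrayRing.own, Carries] using h
  | writeB j A => simpa [GrayRing.own, Carries] using h
  | writeTest j A B =>
    dsimp only at h
    obtain ⟨⟨rfl, h1⟩, rfl, rfl⟩ := h
    simp only [GrayRing.own]
    split_ifs with h2
    · simp only [Carries, true_and]
      intro c l hl
      rcases (show j ≤ l from hl).eq_or_lt with rfl | hl
      · cases c
        · exact h2.1
        · exact h2.2
      · exact h1 c l hl
    · simpa [Carries] using h1
  | invoke c j => simpa [GrayRing.own, Carries] using h
  | writing c j =>
    dsimp only at h
    obtain ⟨⟨rfl, h1⟩, h2⟩ := h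
    cases c
    · simp only [GrayRing.own, Carries, true_and, Function.update_self, implies_true, and_true]
      intro c l hl
      cases c
      · simpa [Function.update_of_ne hl.ne'] using h1 _ l hl
      · simpa using h1 _ l hl
    · simp only [GrayRing.own, Carries, true_and]
      intro c l hl
      rcases (show j ≤ l from hl).eq_or_lt with rfl | hl
      · cases c
        · simpa using h2
        · simp
      · cases c
        · simpa using h1 _ l hl
        · simpa [Function.update_of_ne hl.ne'] using h1 _ l hl

/-- The comparison before each write always succeeds, so no write is invoked again. This is what
makes later reads by the successor reliable. -/
theorem Settled.own {first coin : Bool} {v : Fin K} {q p : Node K} (h : Settled v p)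
    (hc : Calm first v p) : Settled v (own first coin q p) := by
  obtain ⟨pc, X, Y, x, y, R⟩ := p
  obtain ⟨⟨hx, hX, h3⟩, h4⟩ := h
  dsimp only at hx hX h3
  subst hx hX
  cases pc with
  | loopX j =>
    simp only [GrayRing.own]
    split_ifs <;> simp_all [Settled]
  | decodeX =>
    simp only [GrayRing.own, ofNat_grayInv_gray]
    simp_all [Settled]
  | loopY j => simp only [GrayRing.own]; split_ifs <;> simp_all [Settled]
  | aread j m buf t =>
    cases t
    · simp_all [GrayRing.own, Settled]
    · simp only [GrayRing.own]; split_ifs <;> simp_all [Settled]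
  | test =>
    have hc := hc rfl
    cases y with
    | none => simp_all [GrayRing.own, Settled]
    | some z => cases first <;> simp_all [GrayRing.own, Settled]
  | loopW r => simp only [GrayRing.own]; split_ifs <;> simp_all [Settled]
  | writeTest j A B => simp_all [GrayRing.own, Settled]
  | _ => simp_all [GrayRing.own, Settled]

theorem ReadsOnly.own {first coin : Bool} {v : Fin K} {q p : Node K} (h : ReadsOnly v p)
    (hq : ∀ j m buf t, p.pc = PC.aread j m buf t → ∀ c,
      q.R c j = gray _ v.val j ∧ q.busy c j = false) :
    ReadsOnly v (own first coin q p) := by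
  obtain ⟨pc, X, Y, x, y, R⟩ := p
  cases pc with
  | loopX j => simp only [GrayRing.own]; split_ifs <;> simp [ReadsOnly]
  | decodeX => simp [GrayRing.own, ReadsOnly]
  | loopY j =>
    simp only [GrayRing.own]
    split_ifs with hj
    · simp only [ReadsOnly, Fin.not_lt_zero, false_imp_iff, implies_true, ne_eq, reduceCtorEq,
        not_false_eq_true, and_true]
      exact fun l hl => h l hl
    · exact fun l => h l (by omega)
  | aread j m buf t =>
    obtain ⟨h1, h2, h3⟩ := h
    cases t with
    | none => exact ⟨h1, h2, by simp⟩
    | some t =>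
      obtain rfl : t = false := by simpa using h3
      have hq' := hq _ _ _ _ rfl (halfOf m)
      simp only [GrayRing.own, hq'.1, hq'.2, Bool.or_self, Bool.false_eq_true, if_false]
      have hb : ∀ l, l ≤ m → Function.update buf m (gray _ v.val j) l = gray _ v.val j := by
        intro l hl
        rcases hl.eq_or_lt with rfl | hl
        · simp
        · rw [Function.update_of_ne hl.ne, h2 l hl]
      split_ifs with hm
      · refine ⟨h1, fun l hl => hb l ?_, by simp⟩
        have : l.val < m.val + 1 := hl
        rw [Fin.le_def]; omega
      · intro l hl
        have hu := unanimous_eq_some.2 fun l => hb l (by rw [Fin.le_def]; omega)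
        simp only [hu]
        rcases (show l ≤ j from Nat.lt_succ_iff.1 hl).eq_or_lt with rfl | hl
        · simp
        · rw [Function.update_of_ne hl.ne]; exact h1 l hl
  | decodeY => exact ⟨h, decodeRead_gray v _ h⟩
  | test =>
    cases y with
    | none => simp [GrayRing.own, ReadsOnly]
    | some z => simp only [GrayRing.own]; split_ifs <;> simp [ReadsOnly]
  | loopW r => simp only [GrayRing.own]; split_ifs <;> simp [ReadsOnly]
  | writeTest j A B => simp only [GrayRing.own]; split_ifs <;> simp [ReadsOnly]
  | writing c j => cases c <;> simp [GrayRing.own, ReadsOnly]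
  | _ => simp [GrayRing.own, ReadsOnly]

end Predicates

/-! ### Effect of a step of the predecessor -/

section Hear
variable {K : ℕ}

theorem hear_cases (q p : Node K) : hear q p = p ∨ ∃ c l j m buf t,
    q.pc = PC.writing c l ∧ p.pc = PC.aread j m buf (some t) ∧
      hear q p = { p with
        pc := PC.aread j m buf (some (t || decide (j = l ∧ halfOf m = c))) } := by
  unfold hear
  split
  · rename_i c l hq
    unfold Node.overlap
    split
    · rename_i j m buf t hp
      exact Or.inr ⟨c, l, j, m, buf, t, hq, hp, by simp only [eq_comm]⟩
    · exact Or.inl rfl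
  · exact Or.inl rfl

theorem Carries.hear {v : Fin K} {p : Node K} (h : Carries v p) (q : Node K) :
    Carries v (hear q p) := by
  rcases hear_cases q p with h' | ⟨c, l, j, m, buf, t, -, hp, h'⟩
  · rwa [h']
  · rw [h']; unfold Carries at h ⊢; rw [hp] at h; exact h

theorem Settled.hear {v : Fin K} {p : Node K} (h : Settled v p) (q : Node K) :
    Settled v (hear q p) := by
  rcases hear_cases q p with h' | ⟨c, l, j, m, buf, t, -, hp, h'⟩
  · rwa [h']
  · rw [h']; unfold Settled at h ⊢; rw [hp] at h; exact h

theorem Settled.hear_eq {v : Fin K} {q : Node K} (h : Settled v q) (p : Node K) :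
    GrayRing.hear q p = p := by
  rcases hear_cases q p with h' | ⟨c, l, j, m, buf, t, hq, -, -⟩
  · exact h'
  · simp [Settled, hq] at h

theorem Settled.busy {v : Fin K} {q : Node K} (h : Settled v q) (c : Half) (j : Fin (width K)) :
    q.busy c j = false := by
  unfold Node.busy
  split
  · rename_i hq; simp [Settled, hq] at h
  · rfl

end Hear

/-! ### Ranks of control locations -/

/-- A number that decreases in every step of the processor, except in those that leave the reading
part (if `up ≤ low`) or the writing part (if `low ≤ up`) of the loop. -/
def PC.rank {k : ℕ} (up low : ℕ) : PC k → ℕ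
  | PC.loopX j => up + (4 + 10 * k + (k - j.val))
  | PC.decodeX => up + (3 + 10 * k)
  | PC.loopY j => up + (2 + 10 * (k - j.val))
  | PC.aread j m _ none => up + (2 + 10 * (k - j.val) - 1 - 2 * m.val)
  | PC.aread j m _ (some _) => up + (2 + 10 * (k - j.val) - 2 - 2 * m.val)
  | PC.decodeY => up + 1
  | PC.test => up
  | PC.critical => low + (10 * k + 2)
  | PC.encode => low + (10 * k + 1)
  | PC.loopW r => low + 10 * r.val
  | PC.writeA j => low + (10 * j.val + 9)
  | PC.writeB j _ => low + (10 * j.val + 8)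
  | PC.writeTest j _ _ => low + (10 * j.val + 7)
  | PC.invoke Half.a j => low + (10 * j.val + 6)
  | PC.writing Half.a j => low + (10 * j.val + 5)
  | PC.invoke Half.b j => low + (10 * j.val + 4)
  | PC.writing Half.b j => low + (10 * j.val + 3)

theorem rank_hear {K : ℕ} (up low : ℕ) (q p : Node K) :
    (hear q p).pc.rank up low = p.pc.rank up low := by
  rcases hear_cases q p with h' | ⟨c, l, j, m, buf, t, -, hp, h'⟩
  · rw [h']
  · rw [h', hp]; rfl

/-- One ranking serves for both halves of the main loop: the offsets `up` and `low` decide which of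
the two transitions between the halves is allowed to raise the rank. -/
theorem rank_own_lt {K : ℕ} [NeZero K] (up low : ℕ) (first coin : Bool) (q p : Node K)
    (h1 : p.pc = PC.test → low + (10 * width K + 2) < up)
    (h2 : p.pc = PC.loopW 0 → up + (4 + 11 * width K) < low) :
    (own first coin q p).pc.rank up low < p.pc.rank up low := by
  obtain ⟨pc, X, Y, x, y, R⟩ := p
  cases pc with
  | loopX j => simp only [own]; split_ifs <;> simp only [PC.rank] <;> omega
  | decodeX => simp [own, PC.rank]
  | loopY j => simp only [own]; split_ifs <;> simp only [PC.rank, Fin.val_zero] <;> omega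
  | aread j m buf t =>
    cases t with
    | none => simp only [own, PC.rank]; omega
    | some t => simp only [own]; split_ifs <;> simp only [PC.rank, Fin.val_succ] <;> omega
  | test =>
    have h1 := h1 rfl
    cases y with
    | none => simp only [own, PC.rank]; omega
    | some z => simp only [own]; split_ifs <;> simp only [PC.rank] <;> omega
  | loopW r =>
    simp only [own]
    split_ifs with hr
    · simp only [PC.rank]; omega
    · have h2 := h2 (by rw [show r = 0 from Fin.ext (by simpa using hr)])
      simp only [PC.rank, Fin.val_zero]; omega
  | writeTest j A B => simp only [own]; split_ifs <;> simp only [PC.rank, Fin.val_castSucc] <;> omega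
  | invoke c j => cases c <;> simp [own, PC.rank]
  | writing c j => cases c <;> simp [own, PC.rank]
  | _ => simp [own, PC.rank]

/-- Just after the test nothing is required of the registers, so this starts `Carries` from an
arbitrary state. -/
theorem carries_own_of_test {K : ℕ} [NeZero K] {first coin : Bool} {q p : Node K}
    (hp : p.pc = PC.test) : Carries (own first coin q p).x (own first coin q p) := by
  obtain ⟨pc, X, Y, x, y, R⟩ := p
  subst hp
  cases y with
  | none => simp [own, Carries]
  | some z => simp only [own]; split_ifs <;> simp [Carries]

/-! ### Progress -/

section Execution
variable {n K : ℕ} [NeZero n] [NeZero K] {σ : ℕ → Config n K} {sched : ℕ → Fin n}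
  {coin : ℕ → Bool}

theorem apply_succ_of_sched (hstep : ∀ t, σ (t + 1) = step (sched t) (coin t) (σ t)) {t : ℕ}
    {i : Fin n} (hi : sched t = i) :
    σ (t + 1) i = own (decide (i = 0)) (coin t) (σ t (i - 1)) (σ t i) := by
  rw [hstep, hi, step_apply_self]

theorem apply_succ_of_ne (hstep : ∀ t, σ (t + 1) = step (sched t) (coin t) (σ t)) {t : ℕ}
    {i : Fin n} (hi : sched t ≠ i) :
    σ (t + 1) i = if sched t = i - 1 then hear (σ t (i - 1)) (σ t i) else σ t i := by
  rw [hstep, step_apply_of_ne hi.symm]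
  by_cases h : sched t = i - 1
  · rw [if_pos h, if_pos (by rw [h, sub_add_cancel]), h]
  · rw [if_neg h, if_neg fun h' => h (by rw [h', add_sub_cancel_right])]

theorem apply_succ_of_ne_cases (hstep : ∀ t, σ (t + 1) = step (sched t) (coin t) (σ t)) {t : ℕ}
    {i : Fin n} (hi : sched t ≠ i) :
    σ (t + 1) i = hear (σ t (i - 1)) (σ t i) ∨ σ (t + 1) i = σ t i := by
  rw [apply_succ_of_ne hstep hi]
  split_ifs <;> simp

theorem carries_succ (hstep : ∀ t, σ (t + 1) = step (sched t) (coin t) (σ t)) {v : Fin K}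
    {i : Fin n} {t : ℕ} (h : Carries v (σ t i))
    (hc : sched t = i → Calm (decide (i = 0)) v (σ t i)) : Carries v (σ (t + 1) i) := by
  by_cases hi : sched t = i
  · rw [apply_succ_of_sched hstep hi]
    exact h.own (hc hi)
  · rcases apply_succ_of_ne_cases hstep hi with h' | h' <;> rw [h']
    · exact h.hear _
    · exact h

end Execution

theorem exists_next_turn {α : Type*} {sched : ℕ → α}
    (hfair : ∀ i, ∃ᶠ t in Filter.atTop, sched t = i) (i : α)
    (t : ℕ) : ∃ u, t ≤ u ∧ sched u = i ∧ ∀ w, t ≤ w → w < u → sched w ≠ i := by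
  classical
  have h : ∃ u, t ≤ u ∧ sched u = i := Filter.frequently_atTop.1 (hfair i) t
  exact ⟨Nat.find h, (Nat.find_spec h).1, (Nat.find_spec h).2,
    fun w h1 h2 h3 => Nat.find_min h h2 ⟨h1, h3⟩⟩

/-! ### Liveness: a value travels around the ring -/

section Progress
variable {n K : ℕ} [NeZero n] [NeZero K] {σ : ℕ → Config n K} {sched : ℕ → Fin n}
  {coin : ℕ → Bool}

theorem rank_eq_of_no_turn (hstep : ∀ t, σ (t + 1) = step (sched t) (coin t) (σ t))
    (up low : ℕ) {i : Fin n} {t u : ℕ} (htu : t ≤ u)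
    (h : ∀ w, t ≤ w → w < u → sched w ≠ i) :
    (σ u i).pc.rank up low = (σ t i).pc.rank up low := by
  induction u, htu using Nat.le_induction with
  | base => rfl
  | succ u htu ih =>
    rw [← ih fun w h1 h2 => h w h1 (by omega)]
    rcases apply_succ_of_ne_cases hstep (h u htu (by omega)) with h' | h' <;> rw [h']
    exact rank_hear ..

theorem reaches (hstep : ∀ t, σ (t + 1) = step (sched t) (coin t) (σ t))
    (hfair : ∀ i : Fin n, ∃ᶠ t in Filter.atTop, sched t = i) (up low : ℕ)
    (P : PC (width K) → Prop)
    (hP : ∀ (first c : Bool) (q p : Node K), ¬ P p.pc →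
      (own first c q p).pc.rank up low < p.pc.rank up low) (i : Fin n) (t : ℕ) :
    ∃ u, t ≤ u ∧ sched u = i ∧ P (σ u i).pc := by
  induction hr : (σ t i).pc.rank up low using Nat.strong_induction_on generalizing t with
  | _ r ih =>
    obtain ⟨u, htu, hu, hno⟩ := exists_next_turn hfair i t
    by_cases hPu : P (σ u i).pc
    · exact ⟨u, htu, hu, hPu⟩
    · have h1 := rank_eq_of_no_turn hstep up low htu hno
      have h2 := hP (decide (i = 0)) (coin u) (σ u (i - 1)) _ hPu
      rw [← apply_succ_of_sched hstep hu, h1, hr] at h2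
      obtain ⟨w, hw, h⟩ := ih _ h2 (u + 1) rfl
      exact ⟨w, by omega, h⟩

theorem reaches_test (hstep : ∀ t, σ (t + 1) = step (sched t) (coin t) (σ t))
    (hfair : ∀ i : Fin n, ∃ᶠ t in Filter.atTop, sched t = i) (i : Fin n) (t : ℕ) :
    ∃ u, t ≤ u ∧ sched u = i ∧ (σ u i).pc = PC.test :=
  -- Ranks in the reading part are at most `4 + 11 * width K`, so this `low` makes the passage from
  -- writing to reading a descent.
  reaches hstep hfair 0 (4 + 11 * width K + 1) (fun pc => pc = PC.test)
    (fun _ _ _ _ h => rank_own_lt _ _ _ _ _ _ (fun h' => absurd h' h) (fun _ => by omega)) i t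

theorem reaches_loopX_zero (hstep : ∀ t, σ (t + 1) = step (sched t) (coin t) (σ t))
    (hfair : ∀ i : Fin n, ∃ᶠ t in Filter.atTop, sched t = i) (i : Fin n) (t : ℕ) :
    ∃ u, t ≤ u ∧ (σ u i).pc = PC.loopX 0 := by
  -- Ranks in the writing part are at most `10 * width K + 2`; now the passage from reading to
  -- writing is a descent.
  obtain ⟨u, hu, hs, hp⟩ := reaches hstep hfair (10 * width K + 3) 0 (fun pc => pc = PC.loopW 0)
    (fun _ _ _ _ h => rank_own_lt _ _ _ _ _ _ (fun _ => by omega) (fun h' => absurd h' h)) i t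
  refine ⟨u + 1, by omega, ?_⟩
  rw [apply_succ_of_sched hstep hs]
  simp [own, hp]

theorem settled_succ (hstep : ∀ t, σ (t + 1) = step (sched t) (coin t) (σ t)) {v : Fin K}
    {i : Fin n} {t : ℕ} (h : Settled v (σ t i))
    (hc : sched t = i → Calm (decide (i = 0)) v (σ t i)) : Settled v (σ (t + 1) i) := by
  by_cases hi : sched t = i
  · rw [apply_succ_of_sched hstep hi]
    exact h.own (hc hi)
  · rcases apply_succ_of_ne_cases hstep hi with h' | h' <;> rw [h']
    · exact h.hear _
    · exact h

/-- At the next return to the head of the main loop the writing loop is complete, so carrying has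
become settling, which then persists. -/
theorem eventually_settled_of_calm (hstep : ∀ t, σ (t + 1) = step (sched t) (coin t) (σ t))
    (hfair : ∀ i : Fin n, ∃ᶠ t in Filter.atTop, sched t = i) {v : Fin K} {i : Fin n} {T : ℕ}
    (h : Carries v (σ T i))
    (hc : ∀ t, T ≤ t → Carries v (σ t i) → sched t = i → Calm (decide (i = 0)) v (σ t i)) :
    ∃ U, T ≤ U ∧ ∀ t, U ≤ t → Settled v (σ t i) := by
  have hQ : ∀ t, T ≤ t → Carries v (σ t i) := by
    intro t ht
    induction t, ht using Nat.le_induction with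
    | base => exact h
    | succ t ht ih => exact carries_succ hstep ih (hc t ht ih)
  obtain ⟨U, hU, hp⟩ := reaches_loopX_zero hstep hfair i T
  refine ⟨U, hU, fun t ht => ?_⟩
  induction t, ht using Nat.le_induction with
  | base => exact (hQ U hU).settled_of_loopX_zero hp
  | succ t ht ih => exact settled_succ hstep ih (hc t (hU.trans ht) (hQ t (hU.trans ht)))

/-- A round begun after the predecessor settled contains no stale reading and overlaps no write. -/
theorem eventually_readsOnly (hstep : ∀ t, σ (t + 1) = step (sched t) (coin t) (σ t))
    (hfair : ∀ i : Fin n, ∃ᶠ t in Filter.atTop, sched t = i) {v : Fin K} {i : Fin n} {T : ℕ}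
    (h : ∀ t, T ≤ t → Settled v (σ t (i - 1))) :
    ∃ U, T ≤ U ∧ ∀ t, U ≤ t → ReadsOnly v (σ t i) := by
  obtain ⟨U, hU, hp⟩ := reaches_loopX_zero hstep hfair i T
  refine ⟨U, hU, fun t ht => ?_⟩
  induction t, ht using Nat.le_induction with
  | base => simp [ReadsOnly, hp]
  | succ t ht ih =>
    have hq := h t (hU.trans ht)
    by_cases hi : sched t = i
    · rw [apply_succ_of_sched hstep hi]
      exact ih.own fun j _ _ _ _ c => ⟨hq.1.2.2 c j, hq.busy c j⟩
    · rcases apply_succ_of_ne_cases hstep hi with h' | h' <;> rw [h']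
      · rwa [hq.hear_eq]
      · exact ih

/-- The first test of a clean round makes `x = v`; every later test sees `y = v` and changes
nothing. -/
theorem eventually_settled_of_pred (hstep : ∀ t, σ (t + 1) = step (sched t) (coin t) (σ t))
    (hfair : ∀ i : Fin n, ∃ᶠ t in Filter.atTop, sched t = i) {v : Fin K} {i : Fin n} (hi : i ≠ 0)
    {T : ℕ} (h : ∀ t, T ≤ t → Settled v (σ t (i - 1))) :
    ∃ U, T ≤ U ∧ ∀ t, U ≤ t → Settled v (σ t i) := by
  obtain ⟨T₁, hT₁, hr⟩ := eventually_readsOnly hstep hfair h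
  obtain ⟨T₂, hT₂, hs, hp⟩ := reaches_test hstep hfair i T₁
  have hy : (σ T₂ i).y = some v := by
    have := hr T₂ hT₂
    simp only [ReadsOnly, hp] at this
    exact this.2
  have hQ : Carries v (σ (T₂ + 1) i) := by
    have h1 := carries_own_of_test (first := decide (i = 0)) (coin := coin T₂)
      (q := σ T₂ (i - 1)) hp
    have h2 : (own (decide (i = 0)) (coin T₂) (σ T₂ (i - 1)) (σ T₂ i)).x = v := by
      simp only [own, hp, hy, hi]
      split_ifs <;> simp_all
    rw [h2] at h1
    rwa [apply_succ_of_sched hstep hs]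
  obtain ⟨U, hU, hset⟩ := eventually_settled_of_calm hstep hfair hQ fun t ht _ _ hp' => by
    have := hr t (by omega)
    simp only [ReadsOnly, hp'] at this
    simp [hi, this.2]
  exact ⟨U, by omega, hset⟩

theorem mk_succ_sub_one {m : ℕ} (hm : m + 1 < n) :
    (⟨m + 1, hm⟩ : Fin n) - 1 = ⟨m, by omega⟩ := by
  rw [sub_eq_iff_eq_add]
  apply Fin.ext
  rw [Fin.val_add, Fin.val_one', Nat.add_mod_mod, Nat.mod_eq_of_lt hm]

theorem eventually_increments (hstep : ∀ t, σ (t + 1) = step (sched t) (coin t) (σ t))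
    (hfair : ∀ i : Fin n, ∃ᶠ t in Filter.atTop, sched t = i) {v : Fin K} {T : ℕ}
    (h : Carries v (σ T 0)) :
    ∃ t, T ≤ t ∧ sched t = 0 ∧
      (σ t 0).pc = PC.test ∧ (σ t 0).x = v ∧ (σ t 0).y = some v := by
  by_contra hno
  -- Without an increment `p_0` is calm forever, so `v` spreads to all processors and returns to
  -- `p_0`, which must then increment.
  push Not at hno
  have h0 := eventually_settled_of_calm hstep hfair h fun t ht hQ hs hp => by
    simpa using hno t ht hs hp hQ.1
  have hall : ∀ m (hm : m < n), ∃ U, T ≤ U ∧ ∀ t, U ≤ t → Settled v (σ t ⟨m, hm⟩) := by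
    intro m
    induction m with
    | zero => exact fun _ => h0
    | succ m ih =>
      intro hm
      obtain ⟨U, hU, hset⟩ := ih (by omega)
      obtain ⟨U', hU', h'⟩ := eventually_settled_of_pred hstep hfair (v := v)
        (i := ⟨m + 1, hm⟩) (T := U) (by simp [Fin.ext_iff])
        (by rwa [mk_succ_sub_one])
      exact ⟨U', by omega, h'⟩
  obtain ⟨U, hU, hset⟩ := hall (0 - 1 : Fin n).val (0 - 1 : Fin n).isLt
  obtain ⟨U', hU', hr⟩ := eventually_readsOnly hstep hfair (v := v) (i := 0) hset
  obtain ⟨U₀, hU₀, hset₀⟩ := h0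
  obtain ⟨t, ht, hs, hp⟩ := reaches_test hstep hfair (0 : Fin n) (max U' U₀)
  have := hr t (by omega)
  simp only [ReadsOnly, hp] at this
  exact hno t (by omega) hs hp (hset₀ t (by omega)).carries.1 this.2

theorem ofNat_val_add_one (a : ℕ) :
    Fin.ofNat K ((Fin.ofNat K a).val + 1) = Fin.ofNat K (a + 1) := by
  apply Fin.ext
  simp [Fin.ofNat]

/-- The processor `p_0` increments its value from every `v` on. -/
theorem exists_increment_from (hstep : ∀ t, σ (t + 1) = step (sched t) (coin t) (σ t))
    (hfair : ∀ i : Fin n, ∃ᶠ t in Filter.atTop, sched t = i) (v : Fin K) :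
    ∃ t, (σ t 0).pc = PC.test ∧ (σ t 0).x = v ∧ (σ t 0).y = some v := by
  obtain ⟨T, -, hs, hp⟩ := reaches_test hstep hfair (0 : Fin n) 0
  obtain ⟨v₀, hv₀⟩ : ∃ v₀ : Fin K, Carries v₀ (σ (T + 1) 0) :=
    ⟨_, by rw [apply_succ_of_sched hstep hs]; exact carries_own_of_test hp⟩
  have hall : ∀ d : ℕ, ∃ t, Carries (Fin.ofNat K (v₀.val + d)) (σ t 0) := by
    intro d
    induction d with
    | zero => exact ⟨T + 1, by simpa using hv₀⟩
    | succ d ih =>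
      obtain ⟨t, ht⟩ := ih
      obtain ⟨u, -, hsu, hpu, hx, hy⟩ := eventually_increments hstep hfair ht
      refine ⟨u + 1, ?_⟩
      rw [apply_succ_of_sched hstep hsu]
      have h1 := carries_own_of_test (first := decide ((0 : Fin n) = 0)) (coin := coin u)
        (q := σ u (0 - 1)) hpu
      convert h1 using 1
      simp only [own, hpu, hy, hx, decide_true, Bool.true_eq_false, false_and, if_false, and_self,
        if_true, ofNat_val_add_one, add_assoc]
  -- This number of increments leads from `v₀` to `v + K`, hence to `v` modulo `K`, and avoids a
  -- truncated subtraction `v - v₀`.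
  obtain ⟨t, ht⟩ := hall (K - v₀.val + v.val)
  have hv : Fin.ofNat K (v₀.val + (K - v₀.val + v.val)) = v := by
    apply Fin.ext
    have : v₀.val + (K - v₀.val + v.val) = v.val + K := by omega
    simp [Fin.ofNat, this, Nat.mod_eq_of_lt v.isLt]
  rw [hv] at ht
  obtain ⟨u, -, -, h⟩ := eventually_increments hstep hfair ht
  exact ⟨u, h⟩

end Progress

/-! ### Predicates for the safety invariant -/

section Safety
variable {K : ℕ}

/-- All values of the most significant bit `z` are zero outside of the reading procedure, and `x`
is less than `v`. -/
structure Low (v : Fin K) (z : Fin (width K)) (p : Node K) : Prop where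
  reg : ∀ c, p.regVal c z = false
  X : p.X z = false
  x : p.x < v
  bufA : ∀ A, p.pc = PC.writeB z A → A = false
  bufT : ∀ A B, p.pc = PC.writeTest z A B → A = false ∧ B = false

/-- The processor carries `v` and is going to write the most significant bit `z`, whose second
register it has not begun to write. -/
def Rising (v : Fin K) (z : Fin (width K)) (p : Node K) : Prop :=
  Carries v p ∧ p.R Half.b z = false ∧ p.pc ≠ PC.writing Half.b z ∧
    (p.pc = PC.invoke Half.b z ∨ p.R Half.a z = false)

/-- The processor shows `v` in all its registers. -/
def High (v : Fin K) (z : Fin (width K)) (p : Node K) : Prop :=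
  Settled v p ∨ Carries v p ∧ p.pc = PC.writing Half.b z

/-- Neither `Y` nor `y` has the most significant bit. -/
def ReadLow (v : Fin K) (z : Fin (width K)) (p : Node K) : Prop :=
  p.Y z ≠ some true ∧ ∀ w, p.y = some w → w < v

/-- The processor has read the most significant bit `z`, is reading the other ones, and has not
yet acted upon them. -/
def ReadingHigh (v : Fin K) (z : Fin (width K)) (p : Node K) : Prop :=
  ReadsOnly v p ∧
  match p.pc with
  | PC.loopY j => z.val < j.val
  | PC.aread j _ _ _ => z < j
  | PC.decodeY => True
  | PC.test => True
  | _ => False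

/-- All that has been read agrees with `v`, except that the second register of the most
significant bit `z` may have been misread. -/
def ReadHigh (v : Fin K) (z : Fin (width K)) (p : Node K) : Prop :=
  (∀ j, p.Y j = none ∨ p.Y j = some (gray _ v.val j)) ∧ (p.y = none ∨ p.y = some v) ∧
  ∀ j m buf t, p.pc = PC.aread j m buf t →
    (∀ l, l < m → (j ≠ z ∨ halfOf l = Half.a) → buf l = gray _ v.val j) ∧
    ((j ≠ z ∨ halfOf m = Half.a) → t ≠ some true)

/-- A write to the first register of the bit `z` is under way (or imminent), where `X z = a`. -/
def WritesA (a : Bool) (z : Fin (width K)) (q : Node K) : Prop :=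
  q.X z = a ∧ (q.pc = PC.invoke Half.a z ∨ q.pc = PC.writing Half.a z)

/-- The first register of the bit `z` is being raised, or has just been raised. -/
def RaisesA (z : Fin (width K)) (q : Node K) : Prop :=
  q.X z = true ∧ (q.pc = PC.writing Half.a z ∨ q.pc = PC.invoke Half.b z)

/-- What a two-scan read of the bit `z` may have seen as long as the predecessor `q` has not begun
to raise the second register. -/
def Scan (z : Fin (width K)) (p q : Node K) : Prop :=
  ∀ m buf t, p.pc = PC.aread z m buf t → (∀ l, l < m → buf l = true) →
    (m = 1 → t = some true → ¬ WritesA false z q) ∧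
    (m = 2 → ¬ WritesA false z q ∧ (t = some true → RaisesA z q ∧ q.pc = PC.invoke Half.b z)) ∧
    (m = 3 → RaisesA z q ∧ t ≠ some true)

end Safety

/-! ### Safety predicates under own steps -/

section SafetySteps
variable {K : ℕ} {v : Fin K} {z : Fin (width K)}

theorem Node.regVal_of_not_busy {p : Node K} {c : Half} {j : Fin (width K)}
    (h : p.busy c j = false) : p.regVal c j = p.R c j := by simp [Node.regVal, h]

/-- Apart from the second register of the MSB, which may still be under way, everything shown is
final: the MSB comes last in the writing loop and its second register last of all. -/
theorem High.R_eq {p : Node K} (h : High v z p) (hz : z.val = 0) {c : Half} {j : Fin (width K)}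
    (hj : j ≠ z ∨ c = Half.a) : p.R c j = gray _ v.val j ∧ p.busy c j = false := by
  rcases h with h | ⟨h, hp⟩
  · exact ⟨h.1.2.2 c j, h.busy c j⟩
  · simp only [Carries, hp, true_imp_iff] at h
    obtain ⟨-, ⟨-, h1⟩, h2⟩ := h
    by_cases hjz : j = z
    · subst hjz
      obtain rfl := hj.resolve_left (by simp)
      exact ⟨h2, by simp [Node.busy, hp]⟩
    · refine ⟨h1 c j ?_, by simp [Node.busy, hp, Ne.symm hjz]⟩
      rw [Fin.lt_def, hz]
      have : j.val ≠ z.val := fun h => hjz (Fin.ext h)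
      omega

theorem High.X_eq {p : Node K} (h : High v z p) : p.x = v ∧ p.X = gray _ v.val := by
  rcases h with h | ⟨h, hp⟩
  · exact ⟨h.1.1, h.1.2.1⟩
  · simp only [Carries, hp] at h
    exact ⟨h.1, h.2.1.1⟩

theorem High.regVal {p : Node K} (h : High v z p) (hz : z.val = 0) (c : Half)
    (j : Fin (width K)) : p.regVal c j = gray _ v.val j := by
  by_cases hj : j ≠ z ∨ c = Half.a
  · rw [Node.regVal_of_not_busy (h.R_eq hz hj).2, (h.R_eq hz hj).1]
  · unfold Node.regVal
    split_ifs with hb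
    · rw [h.X_eq.2]
    · rcases h with h | ⟨h, hp⟩
      · exact h.1.2.2 c j
      · obtain rfl : j = z := by tauto
        obtain rfl : c = Half.b := by cases c <;> simp_all
        simp [Node.busy, hp] at hb

theorem Low.not_high {p : Node K} (hg : gray _ v.val z = true) (hz : z.val = 0)
    (h : Low v z p) : ¬ High v z p := by
  intro h'
  have := h'.regVal hz Half.b z
  rw [h.reg, hg] at this
  cases this

theorem Rising.X_of_pc {p : Node K} (h : Rising v z p) {c : Half} {j : Fin (width K)}
    (hp : p.pc = PC.invoke c j ∨ p.pc = PC.writing c j) : p.X = gray _ v.val := by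
  rcases hp with hp | hp <;> simp only [Rising, Carries, hp] at h <;> exact h.1.2.1.1

variable [NeZero K]

/-- With MSB zero, decoding stays below `v`, and copying does so by `hy`. The one exit is an
increment from `v - 1`, possible for `p_0` only. -/
theorem Low.own {first coin : Bool} {q p : Node K} (h : Low v z p)
    (hlow : ∀ x : Fin K, x < v → gray (width K) x.val z = false)
    (hdec : ∀ g : Fin (width K) → Bool, g z = false → Fin.ofNat K (grayInv _ g) < v)
    (hy : first = false → p.pc = PC.test → ∀ w, p.y = some w → w < v) :
    Low v z (own first coin q p) ∨ first = true ∧ Rising v z (own first coin q p) := by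
  obtain ⟨pc, X, Y, x, y, R⟩ := p
  obtain ⟨hr, hX, hx, hA, hT⟩ := h
  dsimp only at hX hx hA hT
  cases pc with
  | loopX j =>
    left
    simp only [Node.regVal, Node.busy] at hr
    simp only [GrayRing.own]
    split_ifs with hj
    · refine ⟨by simpa [Node.regVal, Node.busy] using hr, ?_, hx, by simp, by simp⟩
      by_cases hjz : z = ⟨j.val, hj⟩
      · simp only [← hjz, Function.update_self]
        simpa using hr Half.a
      · simp only [Function.update_of_ne hjz, hX]
    · exact ⟨by simpa [Node.regVal, Node.busy] using hr, hX, hx, by simp, by simp⟩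
  | decodeX =>
    exact Or.inl ⟨by simpa [GrayRing.own, Node.regVal, Node.busy] using hr, hX, hdec _ hX,
      by simp [GrayRing.own], by simp [GrayRing.own]⟩
  | loopY j =>
    left
    simp only [GrayRing.own]
    split_ifs <;>
    exact ⟨by simpa [Node.regVal, Node.busy] using hr, hX, hx, by simp, by simp⟩
  | aread j m buf t =>
    left
    cases t with
    | none => exact ⟨by simpa [GrayRing.own, Node.regVal, Node.busy] using hr, hX, hx,
        by simp [GrayRing.own], by simp [GrayRing.own]⟩
    | some t =>
      simp only [GrayRing.own]
      split_ifs <;>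
      exact ⟨by simpa [Node.regVal, Node.busy] using hr, hX, hx, by simp, by simp⟩
  | test =>
    have hr' : ∀ c, R c z = false := by simpa [Node.regVal, Node.busy] using hr
    cases y with
    | none => exact Or.inl ⟨by simpa [GrayRing.own, Node.regVal, Node.busy] using hr, hX, hx,
        by simp [GrayRing.own], by simp [GrayRing.own]⟩
    | some w =>
      simp only [GrayRing.own]
      split_ifs with h1 h2
      · exact Or.inl ⟨by simpa [Node.regVal, Node.busy] using hr, hX, hy h1.1 rfl w rfl,
          by simp, by simp⟩
      -- No wrap-around modulo `K`: `x + 1 ≤ v < K`.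
      · have hlt : x.val + 1 < K := lt_of_le_of_lt (Nat.succ_le_of_lt hx) v.isLt
        rcases (Nat.succ_le_of_lt (show x.val < v.val from hx)).lt_or_eq with h3 | h3
        · refine Or.inl ⟨by simpa [Node.regVal, Node.busy] using hr, hX, ?_, by simp, by simp⟩
          simpa [Fin.lt_def, Fin.ofNat, Nat.mod_eq_of_lt hlt] using h3
        · refine Or.inr ⟨h2.1, ⟨⟨?_, trivial⟩, hr' _, by simp, Or.inr (hr' _)⟩⟩
          exact Fin.ext (by simpa [Fin.ofNat, Nat.mod_eq_of_lt hlt] using h3)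
      · exact Or.inl ⟨by simpa [Node.regVal, Node.busy] using hr, hX, hx, by simp, by simp⟩
  | encode => exact Or.inl ⟨by simpa [GrayRing.own, Node.regVal, Node.busy] using hr, hlow x hx, hx,
      by simp [GrayRing.own], by simp [GrayRing.own]⟩
  | loopW r =>
    left
    simp only [GrayRing.own]
    split_ifs <;>
    exact ⟨by simpa [Node.regVal, Node.busy] using hr, hX, hx, by simp, by simp⟩
  | writeA j =>
    refine Or.inl ⟨by simpa [GrayRing.own, Node.regVal, Node.busy] using hr, hX, hx,
      ?_, by simp [GrayRing.own]⟩
    have := hr Half.a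
    simp only [Node.regVal, Node.busy, Bool.false_eq_true, if_false] at this
    simp only [GrayRing.own, PC.writeB.injEq, and_imp]
    rintro A rfl rfl
    exact this
  | writeB j A =>
    refine Or.inl ⟨by simpa [GrayRing.own, Node.regVal, Node.busy] using hr, hX, hx,
      by simp [GrayRing.own], ?_⟩
    have := hr Half.b
    simp only [Node.regVal, Node.busy, Bool.false_eq_true, if_false] at this
    simp only [GrayRing.own, PC.writeTest.injEq, and_imp]
    rintro A' B' rfl rfl rfl
    exact ⟨hA _ rfl, this⟩
  | writeTest j A B =>
    left
    simp only [GrayRing.own]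
    split_ifs <;>
    exact ⟨by simpa [Node.regVal, Node.busy] using hr, hX, hx, by simp, by simp⟩
  | invoke c j =>
    refine Or.inl ⟨fun c' => ?_, hX, hx, by simp [GrayRing.own], by simp [GrayRing.own]⟩
    have h1 : R c' z = false := by simpa [Node.regVal, Node.busy] using hr c'
    simp only [GrayRing.own, Node.regVal, hX, h1, ite_self]
  | writing c j =>
    refine Or.inl ⟨fun c' => ?_, hX, hx, by cases c <;> simp [GrayRing.own],
      by cases c <;> simp [GrayRing.own]⟩
    have h1 := hr c'
    simp only [Node.regVal, Node.busy] at h1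
    have h2 : Function.update R c (Function.update (R c) j (X j)) c' z = false := by
      by_cases hc : c = c'
      · subst hc
        by_cases hjz : j = z
        · subst hjz; simpa using hX
        · simpa [hjz, Function.update_of_ne (Ne.symm hjz)] using h1
      · simpa [hc, Function.update_of_ne (Ne.symm hc)] using h1
    cases c <;> simpa [GrayRing.own, Node.regVal, Node.busy] using h2
  | _ => exact Or.inl ⟨by simpa [GrayRing.own, Node.regVal, Node.busy] using hr, hX, hx,
      by simp [GrayRing.own], by simp [GrayRing.own]⟩

theorem Low.rising_own {coin : Bool} {q p : Node K} (h : Low v z p) (hp : p.pc = PC.test)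
    (hy : p.y = some v) : Rising v z (GrayRing.own false coin q p) := by
  have hr : ∀ c, p.R c z = false := fun c => by
    simpa [Node.regVal, Node.busy, hp] using h.reg c
  have hx : p.x ≠ v := h.x.ne
  simp only [GrayRing.own, hp, hy, hx, ne_eq, not_false_eq_true, and_self, if_true]
  exact ⟨⟨rfl, trivial⟩, hr _, by simp, Or.inr (hr _)⟩

/-- The phase ends exactly with the invocation of the write to the second MSB register. -/
theorem Rising.own {first coin : Bool} {q p : Node K} (h : Rising v z p) (hz : z.val = 0)
    (hg : gray _ v.val z = true) (hc : Calm first v p) :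
    Rising v z (own first coin q p) ∨ High v z (own first coin q p) := by
  obtain ⟨h1, h2, h3, h4⟩ := h
  have hC := h1.own (coin := coin) (q := q) hc
  -- The second MSB register is still zero, so the writing loop cannot have been completed; this
  -- rules out the locations of the reading part.
  have hcon : ¬ (∀ c l, p.R c l = gray _ v.val l) := fun h => by
    have := h Half.b z
    rw [h2, hg] at this
    cases this
  obtain ⟨pc, X, Y, x, y, R⟩ := p
  dsimp only at h2 h3 h4 hcon
  obtain ⟨h0, h1⟩ := h1
  cases pc with
  | critical => exact Or.inl ⟨hC, h2, by simp [GrayRing.own], Or.inr (by simpa using h4 : R Half.a z = false)⟩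
  | encode => exact Or.inl ⟨hC, h2, by simp [GrayRing.own], Or.inr (by simpa using h4 : R Half.a z = false)⟩
  | loopW r =>
    by_cases hr : 0 < r.val
    · simp only [GrayRing.own, hr, dite_true] at hC ⊢
      exact Or.inl ⟨hC, h2, by simp, Or.inr (by simpa using h4 : R Half.a z = false)⟩
    · exact absurd (fun c l => h1.2 c l (by omega)) hcon
  | writeA j => exact Or.inl ⟨hC, h2, by simp [GrayRing.own], Or.inr (by simpa using h4 : R Half.a z = false)⟩
  | writeB j A => exact Or.inl ⟨hC, h2, by simp [GrayRing.own], Or.inr (by simpa using h4 : R Half.a z = false)⟩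
  | writeTest j A B =>
    refine Or.inl ⟨hC, ?_⟩
    simp only [GrayRing.own]
    split_ifs <;> exact ⟨h2, by simp, Or.inr (by simpa using h4 : R Half.a z = false)⟩
  | invoke c j =>
    by_cases hcj : c = Half.b ∧ j = z
    · obtain ⟨rfl, rfl⟩ := hcj
      exact Or.inr (Or.inr ⟨hC, rfl⟩)
    · refine Or.inl ⟨hC, h2, by simpa [GrayRing.own] using hcj, Or.inr ?_⟩
      rcases h4 with h4 | h4
      · simp at h4; exact absurd h4 hcj
      · exact h4
  | writing c j =>
    have hRa : R Half.a z = false := by simpa using h4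
    refine Or.inl ⟨hC, ?_⟩
    by_cases hjz : j = z
    · subst hjz
      cases c with
      | a => simpa [GrayRing.own] using h2
      | b => simp at h3
    · cases c <;> simp [GrayRing.own, Function.update_of_ne (Ne.symm hjz), h2, hRa]
  | _ => exact absurd h1.2 hcon

theorem High.own {first coin : Bool} {q p : Node K} (h : High v z p) (hz : z.val = 0)
    (hc : Calm first v p) : High v z (own first coin q p) := by
  rcases h with h | ⟨h, hp⟩
  · exact Or.inl (h.own hc)
  · left
    have hC := h.own (coin := coin) (q := q) hc
    have hpc : (GrayRing.own first coin q p).pc = PC.loopW z.castSucc := by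
      simp only [GrayRing.own, hp]
    generalize GrayRing.own first coin q p = p' at hC hpc
    simp only [Carries, hpc, Fin.val_castSucc, hz, Nat.zero_le, true_imp_iff] at hC
    exact ⟨hC, by simp [hpc]⟩

theorem decodeRead_eq_some {Y : Fin (width K) → Option Bool} {w : Fin K}
    (h : decodeRead K Y = some w) : (∀ j, Y j ≠ none) ∧
      w = Fin.ofNat K (grayInv (width K) fun j => (Y j).getD false) := by
  unfold decodeRead at h
  split_ifs at h with h'
  exact ⟨h', by simpa using h.symm⟩

/-- Only bits after the MSB are still to be read, and in a `High` predecessor those are stable. -/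
theorem ReadingHigh.own {first coin : Bool} {q p : Node K} (h : ReadingHigh v z p)
    (hz : z.val = 0) (hq : High v z q) (hp : p.pc ≠ PC.test) :
    ReadingHigh v z (own first coin q p) := by
  refine ⟨h.1.own fun j m buf t hp' c => hq.R_eq hz (Or.inl ?_), ?_⟩
  · have := h.2
    simp only [hp'] at this
    exact this.ne'
  · have := h.2
    obtain ⟨pc, X, Y, x, y, R⟩ := p
    cases pc with
    | loopY j =>
      simp only [GrayRing.own]
      split_ifs
      · exact Fin.lt_def.2 this
      · trivial
    | aread j m buf t =>
      have h' : z < j := this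
      cases t with
      | none => exact h'
      | some t =>
        simp only [GrayRing.own]
        split_ifs
        iterate 2 exact h'
        all_goals exact Nat.lt_succ_of_lt h'
    | decodeY => trivial
    | test => simp at hp
    | _ => exact this.elim

theorem ReadingHigh.readHigh_own {first coin : Bool} {q p : Node K} (h : ReadingHigh v z p)
    (hp : p.pc = PC.test) : ReadHigh v z (GrayRing.own first coin q p) := by
  have := h.1
  simp only [ReadsOnly, hp] at this
  have hpc : ∀ j m buf t, (GrayRing.own first coin q p).pc ≠ PC.aread j m buf t := by
    intros
    simp only [GrayRing.own, hp, this.2]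
    split_ifs <;> simp
  have hY : (GrayRing.own first coin q p).Y = p.Y ∧ (GrayRing.own first coin q p).y = p.y := by
    simp only [GrayRing.own, hp, this.2]
    split_ifs <;> simp
  refine ⟨fun j => ?_, ?_, fun j m buf t h' => absurd h' (hpc j m buf t)⟩
  · rw [hY.1, this.1]; simp
  · rw [hY.2, this.2]; simp

/-- Readings of the second MSB register may be arbitrary while it is being written. Those of the
first are correct, so unanimity forces the correct bit and an error can only give `⊥`. -/
theorem ReadHigh.own {first coin : Bool} {q p : Node K} (h : ReadHigh v z p) (hz : z.val = 0)
    (hq : High v z q) : ReadHigh v z (GrayRing.own first coin q p) := by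
  obtain ⟨pc, X, Y, x, y, R⟩ := p
  obtain ⟨h1, h2, h3⟩ := h
  dsimp only at h1 h2 h3
  cases pc with
  | loopX j => simp only [GrayRing.own]; split_ifs <;> exact ⟨h1, h2, by simp⟩
  | loopY j =>
    simp only [GrayRing.own]
    split_ifs
    · refine ⟨h1, h2, ?_⟩
      simp only [PC.aread.injEq, and_imp]
      rintro _ _ _ _ rfl rfl rfl rfl
      simp
    · exact ⟨h1, h2, by simp⟩
  | aread j m buf t =>
    obtain ⟨h4, h5⟩ := h3 j m buf t rfl
    cases t with
    | none =>
      refine ⟨h1, h2, ?_⟩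
      simp only [GrayRing.own, PC.aread.injEq, and_imp]
      rintro _ _ _ _ rfl rfl rfl rfl
      exact ⟨h4, by simp⟩
    | some t =>
      have hb : ∀ l, l ≤ m → (j ≠ z ∨ halfOf l = Half.a) →
          Function.update buf m (if (t || q.busy (halfOf m) j) = true then coin
            else q.R (halfOf m) j) l = gray _ v.val j := by
        intro l hl hlz
        rcases hl.eq_or_lt with rfl | hl
        · obtain rfl : t = false := by simpa using h5 hlz
          have := hq.R_eq hz hlz
          simp [this.1, this.2]
        · rw [Function.update_of_ne hl.ne, h4 l hl hlz]
      simp only [GrayRing.own]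
      generalize Function.update buf m _ = buf' at hb
      split_ifs with hm
      · refine ⟨h1, h2, ?_⟩
        simp only [PC.aread.injEq, and_imp]
        rintro _ _ _ _ rfl rfl rfl rfl
        refine ⟨fun l hl => hb l ?_, by simp⟩
        have : l.val < m.val + 1 := hl
        rw [Fin.le_def]; omega
      · refine ⟨fun l => ?_, h2, by simp⟩
        by_cases hl : l = j
        · subst hl
          simp only [Function.update_self]
          rcases hu : unanimous buf' with _ | a
          · simp
          · right
            rw [← unanimous_eq_some.1 hu 0, hb 0 (Fin.zero_le _) (Or.inr rfl)]
        · simp only [Function.update_of_ne hl, h1]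
  | decodeY =>
    refine ⟨h1, ?_, by simp [GrayRing.own]⟩
    simp only [GrayRing.own]
    by_cases hY : ∀ j, Y j ≠ none
    · exact Or.inr (decodeRead_gray v Y fun j => (h1 j).resolve_left (hY j))
    · left; simp [decodeRead, hY]
  | test =>
    cases y with
    | none => exact ⟨h1, h2, by simp [GrayRing.own]⟩
    | some w => simp only [GrayRing.own]; split_ifs <;> exact ⟨h1, h2, by simp⟩
  | loopW r => simp only [GrayRing.own]; split_ifs <;> exact ⟨h1, h2, by simp⟩
  | writeTest j A B => simp only [GrayRing.own]; split_ifs <;> exact ⟨h1, h2, by simp⟩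
  | writing c j => cases c <;> exact ⟨h1, h2, by simp [GrayRing.own]⟩
  | _ => exact ⟨h1, h2, by simp [GrayRing.own]⟩

end SafetySteps

/-! ### Safety predicates under steps of the predecessor -/

section Hearing
variable {K : ℕ} {v : Fin K} {z : Fin (width K)}

theorem Low.hear {p : Node K} (h : Low v z p) (q : Node K) : Low v z (hear q p) := by
  rcases hear_cases q p with h' | ⟨c, l, j, m, buf, t, -, hp, h'⟩
  · rwa [h']
  · rw [h']
    refine ⟨fun c => ?_, h.X, h.x, by simp, by simp⟩
    simpa [Node.regVal, Node.busy, hp] using h.reg c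

theorem Rising.hear {p : Node K} (h : Rising v z p) (q : Node K) : Rising v z (hear q p) := by
  rcases hear_cases q p with h' | ⟨c, l, j, m, buf, t, -, hp, h'⟩
  · rwa [h']
  · have hC := h.1.hear q
    rw [h'] at hC ⊢
    refine ⟨hC, h.2.1, by simp, Or.inr (h.2.2.2.resolve_left (by simp [hp]))⟩

theorem High.hear {p : Node K} (h : High v z p) (q : Node K) : High v z (hear q p) := by
  rcases h with h | ⟨h, hpc⟩
  · exact Or.inl (h.hear q)
  · right
    rcases hear_cases q p with h' | ⟨c, l, j, m, buf, t, -, hp, h'⟩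
    · rw [h']; exact ⟨h, hpc⟩
    · simp [hp] at hpc

theorem ReadLow.hear {p : Node K} (h : ReadLow v z p) (q : Node K) : ReadLow v z (hear q p) := by
  rcases hear_cases q p with h' | ⟨c, l, j, m, buf, t, -, hp, h'⟩ <;> rw [h'] <;> exact h

theorem High.pc_of_writing {q : Node K} (h : High v z q) {c : Half} {l : Fin (width K)}
    (hq : q.pc = PC.writing c l) : c = Half.b ∧ l = z := by
  rcases h with h | h
  · simp [Settled, hq] at h
  · simpa [hq] using h.2

theorem ReadingHigh.hear {p q : Node K} (h : ReadingHigh v z p) (hq : High v z q) :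
    ReadingHigh v z (hear q p) := by
  rcases hear_cases q p with h' | ⟨c, l, j, m, buf, t, hqc, hp, h'⟩
  · rwa [h']
  · obtain ⟨-, rfl⟩ := hq.pc_of_writing hqc
    rw [h']
    have h2 := h.2
    have h1 := h.1
    simp only [hp] at h2
    simp only [ReadsOnly, hp] at h1
    exact ⟨by simpa [ReadsOnly, h2.ne'] using h1, h2⟩

theorem ReadHigh.hear {p q : Node K} (h : ReadHigh v z p) (hq : High v z q) :
    ReadHigh v z (hear q p) := by
  rcases hear_cases q p with h' | ⟨c, l, j, m, buf, t, hqc, hp, h'⟩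
  · rwa [h']
  · obtain ⟨rfl, rfl⟩ := hq.pc_of_writing hqc
    obtain ⟨h4, h5⟩ := h.2.2 j m buf _ hp
    rw [h']
    refine ⟨h.1, h.2.1, ?_⟩
    simp only [PC.aread.injEq, and_imp]
    rintro _ _ _ _ rfl rfl rfl rfl
    refine ⟨h4, fun hj => ?_⟩
    have h5 := h5 hj
    have : ¬ (j = l ∧ halfOf m = Half.b) := by
      rintro ⟨rfl, h6⟩
      simp [h6] at hj
    simpa [this] using h5

end Hearing

/-! ### The two-scan read of the most significant bit -/

section Scanning
variable {K : ℕ} {v : Fin K} {z : Fin (width K)}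

/-- The processor has not begun to raise the second register of the most significant bit. -/
def Below (v : Fin K) (z : Fin (width K)) (q : Node K) : Prop := Low v z q ∨ Rising v z q

theorem Below.R_b {q : Node K} (h : Below v z q) (hb : q.busy Half.b z = false) :
    q.R Half.b z = false := by
  rcases h with h | h
  · rw [← Node.regVal_of_not_busy hb, h.reg]
  · exact h.2.1

theorem Below.raisesA {q : Node K} (h : Below v z q) (hg : gray _ v.val z = true)
    (hb : q.busy Half.a z = false) (hR : q.R Half.a z = true) :
    RaisesA z q ∧ q.pc = PC.invoke Half.b z := by
  rcases h with h | h
  · rw [← Node.regVal_of_not_busy hb, h.reg] at hR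
    cases hR
  · have hp := h.2.2.2.resolve_right (by simp [hR])
    exact ⟨⟨by rw [h.X_of_pc (Or.inl hp), hg], Or.inr hp⟩, hp⟩

theorem Node.pc_of_busy {q : Node K} {c : Half} {j : Fin (width K)} (h : q.busy c j = true) :
    q.pc = PC.writing c j := by
  unfold Node.busy at h
  split at h
  · rename_i hq
    obtain ⟨rfl, rfl⟩ := of_decide_eq_true h
    exact hq
  · cases h

variable [NeZero K]

/-- An MSB equal to one can enter only through the fourth reading of a unanimous scan. The second
alternative exposes that reading so that `Scan` can refute it while the predecessor is not `High`.
-/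
theorem ReadLow.own {first coin : Bool} {q p : Node K} (h : ReadLow v z p) (hz : z.val = 0)
    (hg : gray _ v.val z = true)
    (hdec : ∀ g : Fin (width K) → Bool, g z = false → Fin.ofNat K (grayInv _ g) < v) :
    ReadLow v z (own first coin q p) ∨ ReadingHigh v z (GrayRing.own first coin q p) ∧
      ∃ buf t, p.pc = PC.aread z 3 buf (some t) ∧ (∀ l, l < 3 → buf l = true) ∧
        (if t || q.busy Half.b z then coin else q.R Half.b z) = true := by
  obtain ⟨pc, X, Y, x, y, R⟩ := p
  obtain ⟨h1, h2⟩ := h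
  dsimp only at h1 h2
  cases pc with
  | loopX j => left; simp only [GrayRing.own]; split_ifs <;> exact ⟨h1, h2⟩
  | loopY j => left; simp only [GrayRing.own]; split_ifs <;> exact ⟨h1, h2⟩
  | aread j m buf t =>
    cases t with
    | none => exact Or.inl ⟨h1, h2⟩
    | some t =>
      by_cases hm : m.val + 1 < 4
      · simp only [GrayRing.own, hm, dite_true]
        exact Or.inl ⟨h1, h2⟩
      · obtain rfl : m = 3 := Fin.ext (by simp; omega)
        by_cases hj : j = z
        · subst hj
          have hhalf : halfOf 3 = Half.b := rfl
          have hm' : ¬ ((3 : Fin 4).val + 1 < 4) := hm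
          simp only [GrayRing.own, hm', dite_false, hhalf]
          generalize hw : (if (t || q.busy Half.b j) = true then coin else q.R Half.b j) = w
          by_cases hu : unanimous (Function.update buf 3 w) = some true
          · right
            have hu' := unanimous_eq_some.1 hu
            refine ⟨⟨?_, ?_⟩, buf, t, rfl, fun l hl => ?_, by rw [hw]; simpa using hu' 3⟩
            · intro l hl
              have : l = j := by
                apply Fin.ext
                have : l.val < j.val + 1 := hl
                omega
              subst this
              simp [hu, hg]
            · exact Nat.lt_succ_self j.val
            · simpa [Function.update_of_ne hl.ne] using hu' l
          · exact Or.inl ⟨by simpa using hu, h2⟩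
        · simp only [GrayRing.own, hm, dite_false]
          exact Or.inl ⟨by simpa [Function.update_of_ne (Ne.symm hj)] using h1, h2⟩
  | decodeY =>
    refine Or.inl ⟨h1, fun w hw => ?_⟩
    obtain ⟨hY, rfl⟩ := decodeRead_eq_some hw
    refine hdec _ ?_
    have := hY z
    rcases hYz : Y z with _ | _ | _ <;> simp_all
  | test =>
    left
    cases y with
    | none => exact ⟨h1, h2⟩
    | some w => simp only [GrayRing.own]; split_ifs <;> exact ⟨h1, h2⟩
  | loopW r => left; simp only [GrayRing.own]; split_ifs <;> exact ⟨h1, h2⟩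
  | writeTest j A B => left; simp only [GrayRing.own]; split_ifs <;> exact ⟨h1, h2⟩
  | _ => exact Or.inl ⟨h1, h2⟩

/-- A flash state may contain an unfinished rewriting of zeros, whose overlap can falsify readings.
Reading one from b the first time means that such a write has reached b, so its write to a is over.
Reading one from a again then means that a is really being, or has been, raised. The last reading of
b meets no write and a stored zero. -/
theorem Scan.own {first coin : Bool} {q p : Node K} (h : Scan z p q) (hq : Below v z q)
    (hg : gray _ v.val z = true) : Scan z (own first coin q p) q := by
  obtain ⟨pc, X, Y, x, y, R⟩ := p
  cases pc with
  | loopX j => simp only [GrayRing.own]; split_ifs <;> simp [Scan]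
  | loopY j =>
    simp only [GrayRing.own]
    split_ifs
    · simp only [Scan, PC.aread.injEq, and_imp]
      rintro _ _ _ _ rfl rfl rfl
      simp
    · simp [Scan]
  | aread j m buf t =>
    cases t with
    | none =>
      simp only [Scan, GrayRing.own, PC.aread.injEq, and_imp]
      rintro _ _ _ rfl rfl rfl rfl hb
      have := h _ _ _ rfl hb
      exact ⟨by simp, fun h2 => ⟨(this.2.1 h2).1, by simp⟩, fun h3 => ⟨(this.2.2 h3).1, by simp⟩⟩
    | some t =>
      by_cases hm : m.val + 1 < 4
      · simp only [GrayRing.own, hm, dite_true, Scan, PC.aread.injEq, and_imp]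
        rintro _ _ _ rfl rfl rfl rfl hb
        have hbm := hb m (by rw [Fin.lt_def]; simp)
        simp only [Function.update_self] at hbm
        have hold := h m buf _ rfl fun l hl => by
          have := hb l (by rw [Fin.lt_def] at hl ⊢; simp only; omega)
          rwa [Function.update_of_ne hl.ne] at this
        refine ⟨by simp, fun h2 => ⟨?_, by simp⟩, fun h3 => ⟨?_, by simp⟩⟩
        · obtain rfl : m = 1 := by
            have := congrArg Fin.val h2
            exact Fin.ext (by simp at this; simpa using this)
          have hhalf : halfOf 1 = Half.b := rfl
          rw [hhalf] at hbm
          -- As b holds zero, the reading one needs an overlapping write to b, either completed or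
          -- in progress.
          by_cases ht : t = true
          · exact hold.1 rfl (by rw [ht])
          · by_cases hbusy : q.busy Half.b j = true
            · have := Node.pc_of_busy hbusy
              simp [WritesA, this]
            · simp only [Bool.not_eq_true] at ht hbusy
              simp [ht, hbusy, hq.R_b hbusy] at hbm
        · obtain rfl : m = 2 := by
            have := congrArg Fin.val h3
            exact Fin.ext (by simp at this; simpa using this)
          have hhalf : halfOf 2 = Half.a := rfl
          rw [hhalf] at hbm
          obtain ⟨hw, hr⟩ := hold.2.1 rfl
          -- Three sources of the reading one: a completed overlapping write, one in progress, or a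
          -- stored one. As no zero is being written to a, each is due to the raising of a.
          by_cases ht : t = true
          · exact (hr (by rw [ht])).1
          · by_cases hbusy : q.busy Half.a j = true
            · have hpc := Node.pc_of_busy hbusy
              refine ⟨?_, Or.inl hpc⟩
              by_contra hX
              exact hw ⟨by simpa using hX, Or.inr hpc⟩
            · simp only [Bool.not_eq_true] at ht hbusy
              simp only [ht, hbusy, Bool.or_self, Bool.false_eq_true, if_false] at hbm
              exact (hq.raisesA hg hbusy hbm).1
      · simp [GrayRing.own, hm, Scan]
  | test =>
    cases y with
    | none => simp [GrayRing.own, Scan]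
    | some w => simp only [GrayRing.own]; split_ifs <;> simp [Scan]
  | loopW r => simp only [GrayRing.own]; split_ifs <;> simp [Scan]
  | writeTest j A B => simp only [GrayRing.own]; split_ifs <;> simp [Scan]
  | writing c j => cases c <;> simp [GrayRing.own, Scan]
  | _ => simp [GrayRing.own, Scan]

/-- Rewriting zero never starts afresh: in `Low` the comparison finds both registers equal to the
zero in `X`, and in `Rising` the MSB of `X` is one. -/
theorem Below.not_writesA_own {first coin : Bool} {r q : Node K} (h : Below v z q)
    (hg : gray _ v.val z = true) (hw : ¬ WritesA false z q) :
    ¬ WritesA false z (own first coin r q) := by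
  rintro ⟨hX, hpc⟩
  obtain ⟨pc, X, Y, x, y, R⟩ := q
  cases pc with
  | loopX j => revert hpc; simp only [GrayRing.own]; split_ifs <;> simp
  | loopY j => revert hpc; simp only [GrayRing.own]; split_ifs <;> simp
  | aread j m buf t =>
    revert hpc
    cases t
    · simp [GrayRing.own]
    · simp only [GrayRing.own]; split_ifs <;> simp
  | test =>
    revert hpc
    cases y with
    | none => simp [GrayRing.own]
    | some w => simp only [GrayRing.own]; split_ifs <;> simp
  | loopW r => revert hpc; simp only [GrayRing.own]; split_ifs <;> simp
  | writing c j => revert hpc; cases c <;> simp [GrayRing.own]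
  | invoke c j =>
    refine hw ⟨hX, ?_⟩
    simpa [GrayRing.own] using hpc
  | writeTest j A B =>
    revert hX hpc
    simp only [GrayRing.own]
    split_ifs with hAB
    · simp
    · simp only [PC.invoke.injEq, true_and, or_false]
      rintro hX rfl
      rcases h with h | h
      · have := h.bufT A B rfl
        simp [this, hX] at hAB
      · have := h.1
        simp only [Carries] at this
        rw [this.2.1.1, hg] at hX
        cases hX
  | _ => revert hpc; simp [GrayRing.own]

/-- The only step compatible with staying `Below` completes the write to a; a step from the
invocation of the write to b would start that write. -/
theorem RaisesA.own {first coin : Bool} {r q : Node K} (h : RaisesA z q)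
    (hq : Below v z (own first coin r q)) :
    RaisesA z (GrayRing.own first coin r q) ∧ q.pc ≠ PC.invoke Half.b z ∧
      (GrayRing.own first coin r q).pc = PC.invoke Half.b z := by
  obtain ⟨pc, X, Y, x, y, R⟩ := q
  obtain ⟨hX, hp⟩ := h
  dsimp only at hX hp
  rcases hp with rfl | rfl
  · exact ⟨⟨hX, Or.inr rfl⟩, by simp, rfl⟩
  · rcases hq with hq | hq
    · have := hq.X
      simp [GrayRing.own, hX] at this
    · exact absurd rfl hq.2.2.1

theorem Scan.hear {first coin : Bool} {r q p : Node K} (h : Scan z p q) (hq : Below v z q)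
    (hg : gray _ v.val z = true) (hq' : Below v z (GrayRing.own first coin r q)) :
    Scan z (hear q p) (GrayRing.own first coin r q) := by
  have key : ∀ m buf t t', p.pc = PC.aread z m buf t → (∀ l, l < m → buf l = true) →
      (t' = some true → t = some true ∨ q.pc = PC.writing (halfOf m) z) →
      (m = 1 → t' = some true → ¬ WritesA false z (GrayRing.own first coin r q)) ∧
      (m = 2 → ¬ WritesA false z (GrayRing.own first coin r q) ∧
        (t' = some true → RaisesA z (GrayRing.own first coin r q) ∧
          (GrayRing.own first coin r q).pc = PC.invoke Half.b z)) ∧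
      (m = 3 → RaisesA z (GrayRing.own first coin r q) ∧ t' ≠ some true) := by
    intro m buf t t' hp hb ht
    obtain ⟨h1, h2, h3⟩ := h m buf t hp hb
    refine ⟨?_, ?_, ?_⟩
    · rintro rfl htt
      refine hq.not_writesA_own hg ?_
      rcases ht htt with ht | ht
      · exact h1 rfl ht
      · have hhalf : halfOf 1 = Half.b := rfl
        simp [WritesA, ht, hhalf]
    · rintro rfl
      obtain ⟨h4, h5⟩ := h2 rfl
      refine ⟨hq.not_writesA_own hg h4, fun htt => ?_⟩
      have hR : RaisesA z q := by
        rcases ht htt with ht | ht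
        · exact (h5 ht).1
        · refine ⟨?_, Or.inl ht⟩
          by_contra hX
          exact h4 ⟨by simpa using hX, Or.inr ht⟩
      exact ⟨(hR.own hq').1, (hR.own hq').2.2⟩
    · rintro rfl
      obtain ⟨h4, h5⟩ := h3 rfl
      refine ⟨(h4.own hq').1, fun htt => ?_⟩
      rcases ht htt with ht | ht
      · exact h5 ht
      · have hhalf : halfOf 3 = Half.b := rfl
        rcases h4.2 with h6 | h6 <;> simp [ht, hhalf] at h6
  rcases hear_cases q p with h' | ⟨c, l, j, m, buf, t, hqc, hp, h'⟩
  · rw [h']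
    exact fun m buf t hp hb => key m buf t t hp hb Or.inl
  · rw [h']
    simp only [Scan, PC.aread.injEq, and_imp]
    rintro _ _ _ rfl rfl rfl rfl hb
    refine key m buf _ _ hp hb fun ht => ?_
    simp only [Option.some.injEq, Bool.or_eq_true, decide_eq_true_eq] at ht
    rcases ht with rfl | ⟨rfl, rfl⟩
    · exact Or.inl rfl
    · exact Or.inr hqc

end Scanning

/-! ### The invariant of a processor and its predecessor -/

section Invariant
variable {K : ℕ} {v : Fin K} {z : Fin (width K)}

/-- The invariant of a processor `p` with predecessor `q` that holds until `p_0` increments the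
value `v`, the smallest one whose Gray code has the most significant bit `z`. -/
def Inv (v : Fin K) (z : Fin (width K)) (first : Bool) (p q : Node K) : Prop :=
  (Low v z p ∧ ReadLow v z p ∧ (High v z q ∨ Scan z p q)) ∨
  (first = true ∧ (Rising v z p ∨ High v z p) ∧ ReadLow v z p ∧ (High v z q ∨ Scan z p q)) ∨
  (ReadingHigh v z p ∧ High v z q ∧
    (first = true ∧ High v z p ∨ first = false ∧ Low v z p)) ∨
  (first = false ∧ (Rising v z p ∨ High v z p) ∧ ReadHigh v z p ∧ High v z q)

theorem Inv.hear_pred {first : Bool} {p q : Node K} (h : Inv v z first p q) (r : Node K) :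
    Inv v z first p (hear r q) := by
  have hS : (High v z q ∨ Scan z p q) → (High v z (hear r q) ∨ Scan z p (hear r q)) := by
    refine Or.imp (fun h => h.hear r) fun h1 => ?_
    rcases hear_cases r q with h' | ⟨c, l, j, m, buf, t, -, hq, h'⟩ <;> rw [h']
    · exact h1
    · simpa [Scan, WritesA, RaisesA, hq] using h1
  rcases h with ⟨h1, h2, h3⟩ | ⟨h1, h2, h3, h4⟩ | ⟨h1, h2, h3⟩ | ⟨h1, h2, h3, h4⟩
  · exact Or.inl ⟨h1, h2, hS h3⟩
  · exact Or.inr (Or.inl ⟨h1, h2, h3, hS h4⟩)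
  · exact Or.inr (Or.inr (Or.inl ⟨h1, h2.hear r, h3⟩))
  · exact Or.inr (Or.inr (Or.inr ⟨h1, h2, h3, h4.hear r⟩))

/-- The processor `p` is going to increment (or to confirm) the value `v`. -/
def Fires (v : Fin K) (p : Node K) : Prop := p.pc = PC.test ∧ p.x = v ∧ p.y = some v

theorem Inv.below_or_high {first : Bool} {p q : Node K} (h : Inv v z first p q) :
    Below v z p ∨ High v z p := by
  unfold Below
  rcases h with ⟨h, -⟩ | ⟨-, h, -⟩ | ⟨-, -, ⟨-, h⟩ | ⟨-, h⟩⟩ | ⟨-, h, -⟩ <;> tauto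

theorem ReadLow.y_ne {p : Node K} (h : ReadLow v z p) : p.y ≠ some v :=
  fun h' => lt_irrefl v (h.2 v h')

theorem Inv.calm {first : Bool} {p q : Node K} (h : Inv v z first p q)
    (hf : first = true → ¬ Fires v p) (hp : Rising v z p ∨ High v z p) : Calm first v p := by
  have hx : p.x = v := by
    rcases hp with hp | hp
    · exact hp.1.1
    · exact hp.X_eq.1
  intro htest
  rcases h with ⟨h, -⟩ | ⟨rfl, -, h, -⟩ | ⟨-, -, ⟨rfl, h⟩ | ⟨-, h⟩⟩ | ⟨rfl, -, h, -⟩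
  · exact absurd hx h.x.ne
  · simpa using h.y_ne
  · simpa using fun hy => hf rfl ⟨htest, hx, hy⟩
  · exact absurd hx h.x.ne
  · simpa using h.2.1

/-- A processor other than `p_0` obtains `v` only by copying it; this drives the backward
propagation in `all_high`. -/
theorem Inv.high_pred {p q : Node K} (hz : z.val = 0) (hg : gray _ v.val z = true)
    (h : Inv v z false p q) (hp : High v z p) : ReadHigh v z p ∧ High v z q := by
  rcases h with ⟨h, -⟩ | ⟨h, -⟩ | ⟨-, -, ⟨h, -⟩ | ⟨-, h⟩⟩ | ⟨-, -, h⟩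
  · exact absurd hp (h.not_high hg hz)
  · cases h
  · cases h
  · exact absurd hp (h.not_high hg hz)
  · exact h

variable [NeZero K]

theorem Inv.high_own {first coin : Bool} {p q r : Node K} (hz : z.val = 0)
    (h : Inv v z first p q) (hf : first = true → ¬ Fires v p) (hp : High v z p) :
    High v z (own first coin r p) :=
  hp.own hz (h.calm hf (Or.inr hp))

theorem Inv.own {first coin : Bool} {p q : Node K} (h : Inv v z first p q) (hz : z.val = 0)
    (hg : gray _ v.val z = true)
    (hlow : ∀ x : Fin K, x < v → gray (width K) x.val z = false)
    (hdec : ∀ g : Fin (width K) → Bool, g z = false → Fin.ofNat K (grayInv _ g) < v)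
    (hq : Below v z q ∨ High v z q) (hpq : first = true → High v z q → High v z p)
    (hf : first = true → ¬ Fires v p) : Inv v z first (GrayRing.own first coin q p) q := by
  have hRH : Rising v z p ∨ High v z p → Rising v z (GrayRing.own first coin q p) ∨
      High v z (GrayRing.own first coin q p) := fun hp =>
    hp.elim (fun hp' => hp'.own hz hg (h.calm hf hp))
      (fun hp' => Or.inr (hp'.own hz (h.calm hf hp)))
  have hRead : ReadLow v z p → (High v z q ∨ Scan z p q) →
      (ReadLow v z (GrayRing.own first coin q p) ∧
        (High v z q ∨ Scan z (GrayRing.own first coin q p) q)) ∨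
      (ReadingHigh v z (GrayRing.own first coin q p) ∧ High v z q) := by
    intro h1 h2
    by_cases hH : High v z q
    · exact (h1.own hz hg hdec).imp (fun h => ⟨h, Or.inl hH⟩) (fun h => ⟨h.1, hH⟩)
    · have hB := hq.resolve_right hH
      have hS := h2.resolve_left hH
      rcases h1.own (coin := coin) (first := first) (q := q) hz hg hdec with
        h3 | ⟨-, buf, t, hpc, hb, hval⟩
      · exact Or.inl ⟨h3, Or.inr (hS.own hB hg)⟩
      -- The fourth reading cannot be one: by `Scan` the predecessor is only raising a, so b is
      -- stored as zero and no write to it overlaps.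
      · exfalso
        obtain ⟨hr, ht⟩ := (hS 3 buf _ hpc hb).2.2 rfl
        have hbusy : q.busy Half.b z = false := by
          by_contra hbusy
          have := Node.pc_of_busy (Bool.not_eq_false _ ▸ hbusy)
          rcases hr.2 with h6 | h6 <;> simp [this] at h6
        have ht' : t = false := by simpa using ht
        simp [ht', hbusy, hB.R_b hbusy] at hval
  have h₀ := h
  rcases h with ⟨h1, h2, h3⟩ | ⟨rfl, h1, h2, h3⟩ | ⟨h1, h2, ⟨rfl, h3⟩ | ⟨rfl, h3⟩⟩ |
    ⟨rfl, h1, h2, h3⟩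
  · rcases hRead h2 h3 with ⟨h4, h5⟩ | ⟨h4, h5⟩
    · rcases h1.own (coin := coin) (q := q) hlow hdec (fun _ _ => h2.2) with h6 | ⟨h6, h7⟩
      · exact Or.inl ⟨h6, h4, h5⟩
      · exact Or.inr (Or.inl ⟨h6, Or.inl h7, h4, h5⟩)
    -- If the predecessor of `p_0` is `High`, so is `p_0`, by `hpq`; thus `p_0` is not `Low` here.
    · have hfirst : first = false := by
        by_contra hne
        exact h1.not_high hg hz (hpq (by simpa using hne) h5)
      rcases h1.own (coin := coin) (q := q) hlow hdec (fun _ _ => h2.2) with h6 | ⟨h6, -⟩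
      · exact Or.inr (Or.inr (Or.inl ⟨h4, h5, Or.inr ⟨hfirst, h6⟩⟩))
      · rw [hfirst] at h6; cases h6
  · rcases hRead h2 h3 with ⟨h4, h5⟩ | ⟨h4, h5⟩
    · exact Or.inr (Or.inl ⟨rfl, hRH h1, h4, h5⟩)
    · exact Or.inr (Or.inr (Or.inl ⟨h4, h5, Or.inl ⟨rfl, h₀.high_own hz hf (hpq rfl h5)⟩⟩))
  · have hpc : p.pc ≠ PC.test := fun hpc => by
      have := h1.1
      simp only [ReadsOnly, hpc] at this
      exact hf rfl ⟨hpc, h3.X_eq.1, this.2⟩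
    exact Or.inr (Or.inr (Or.inl ⟨h1.own hz h2 hpc, h2, Or.inl ⟨rfl, h₀.high_own hz hf h3⟩⟩))
  · by_cases hpc : p.pc = PC.test
    · have := h1.1
      simp only [ReadsOnly, hpc] at this
      exact Or.inr (Or.inr (Or.inr ⟨rfl, Or.inl (h3.rising_own hpc this.2),
        h1.readHigh_own hpc, h2⟩))
    · rcases h3.own (first := false) (coin := coin) (q := q) hlow hdec
        (fun _ h => absurd h hpc) with h6 | ⟨h6, -⟩
      · exact Or.inr (Or.inr (Or.inl ⟨h1.own hz h2 hpc, h2, Or.inr ⟨rfl, h6⟩⟩))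
      · cases h6
  · exact Or.inr (Or.inr (Or.inr ⟨rfl, hRH h1, h2.own hz h3, h3⟩))

theorem Inv.hear {first first' coin : Bool} {p q r : Node K} (h : Inv v z first p q)
    (hg : gray _ v.val z = true) (hq : Below v z q ∨ High v z q)
    (hq' : Below v z (GrayRing.own first' coin r q) ∨ High v z (GrayRing.own first' coin r q))
    (hqq : High v z q → High v z (GrayRing.own first' coin r q)) :
    Inv v z first (hear q p) (GrayRing.own first' coin r q) := by
  have hS : (High v z q ∨ Scan z p q) → (High v z (GrayRing.own first' coin r q) ∨
      Scan z (GrayRing.hear q p) (GrayRing.own first' coin r q)) := by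
    intro h1
    by_cases hH : High v z (GrayRing.own first' coin r q)
    · exact Or.inl hH
    · have hH' : ¬ High v z q := fun h => hH (hqq h)
      exact Or.inr ((h1.resolve_left hH').hear (hq.resolve_right hH') hg (hq'.resolve_right hH))
  have hRH : Rising v z p ∨ High v z p → Rising v z (GrayRing.hear q p) ∨
      High v z (GrayRing.hear q p) := Or.imp (fun h => h.hear q) (fun h => h.hear q)
  rcases h with ⟨h1, h2, h3⟩ | ⟨rfl, h1, h2, h3⟩ | ⟨h1, h2, h3⟩ | ⟨rfl, h1, h2, h3⟩
  · exact Or.inl ⟨h1.hear q, h2.hear q, hS h3⟩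
  · exact Or.inr (Or.inl ⟨rfl, hRH h1, h2.hear q, hS h3⟩)
  · exact Or.inr (Or.inr (Or.inl ⟨h1.hear h2, hqq h2,
      h3.imp (fun h => ⟨h.1, h.2.hear q⟩) (fun h => ⟨h.1, h.2.hear q⟩)⟩))
  · exact Or.inr (Or.inr (Or.inr ⟨rfl, hRH h1, h2.hear h3, hqq h3⟩))

end Invariant

/-! ### From local invariants to the whole ring -/

section Global
variable {n K : ℕ} [NeZero n] {v : Fin K} {z : Fin (width K)}

theorem all_high (hz : z.val = 0) (hg : gray _ v.val z = true) {s : Config n K}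
    (h : ∀ i, Inv v z (decide (i = 0)) (s i) (s (i - 1))) (hlast : High v z (s (0 - 1)))
    (i : Fin n) : High v z (s i) := by
  have hn : 0 < n := Nat.pos_of_ne_zero (NeZero.ne n)
  induction hd : n - 1 - i.val generalizing i with
  | zero =>
    convert hlast
    rw [eq_sub_iff_add_eq]
    apply Fin.ext
    have : i.val + 1 = n := by omega
    rw [Fin.val_add, Fin.val_one', Nat.add_mod_mod, this, Nat.mod_self, Fin.val_zero]
  | succ d ih =>
    have hi : i.val + 1 < n := by omega
    have h1 := ih ⟨i.val + 1, hi⟩ (by simp only; omega)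
    have h2 := h ⟨i.val + 1, hi⟩
    rw [mk_succ_sub_one, decide_eq_false fun h0 => absurd (congrArg Fin.val h0) (by simp)] at h2
    exact (h2.high_pred hz hg h1).2

/-- Having read `v`, `p_0` has a `High` predecessor, so all are `High`. The reads of the other
processors are covered by `ReadHigh`, whose possible `⊥` is not a bit value. -/
theorem isHome_of_fires (hz : z.val = 0) (hg : gray _ v.val z = true) {s : Config n K}
    (h : ∀ i, Inv v z (decide (i = 0)) (s i) (s (i - 1))) (hf : Fires v (s 0)) :
    IsHome s := by
  obtain ⟨hpc, hx, hy⟩ := hf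
  have h0 := h 0
  rw [decide_eq_true rfl] at h0
  have h1 : ReadingHigh v z (s 0) ∧ High v z (s (0 - 1)) := by
    rcases h0 with ⟨h1, -⟩ | ⟨-, -, h1, -⟩ | ⟨h1, h2, -⟩ | ⟨h1, -⟩
    · exact absurd hx h1.x.ne
    · exact absurd hy h1.y_ne
    · exact ⟨h1, h2⟩
    · cases h1
  have hall := all_high hz hg h h1.2
  have hread : ∀ i, (∀ j, (s i).Y j = none ∨ (s i).Y j = some (gray _ v.val j)) ∧
      ((s i).y = none ∨ (s i).y = some v) := by
    intro i
    by_cases hi : i = 0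
    · subst hi
      have := h1.1.1
      simp only [ReadsOnly, hpc] at this
      exact ⟨fun j => Or.inr (this.1 j), Or.inr this.2⟩
    · have h2 := h i
      rw [decide_eq_false hi] at h2
      have h3 := (h2.high_pred hz hg (hall i)).1
      exact ⟨h3.1, h3.2.1⟩
  refine fun j => ⟨gray _ v.val j, fun i w hw => ?_⟩
  rcases hw with ⟨c, rfl⟩ | rfl | hw | rfl | ⟨u, hu, rfl⟩
  · exact (hall i).regVal hz c j
  · rw [(hall i).X_eq.2]
  · rcases (hread i).1 j with h2 | h2 <;> rw [h2] at hw
    · cases hw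
    · exact (Option.some.inj hw).symm
  · rw [(hall i).X_eq.1]
  · rcases (hread i).2 with h2 | h2 <;> rw [h2] at hu
    · cases hu
    · rw [Option.some.inj hu]

theorem inv_of_isFlash [NeZero K]
    (hdec : ∀ g : Fin (width K) → Bool, g z = false → Fin.ofNat K (grayInv _ g) < v)
    (hz : z.val = 0) {s : Config n K} (h : IsFlash s) (i : Fin n) :
    Inv v z (decide (i = 0)) (s i) (s (i - 1)) := by
  obtain ⟨h1, h2⟩ := h i z hz
  simp only [Node.Holds, not_or, not_exists, not_and, Bool.not_eq_true] at h1
  obtain ⟨hr, hX, hY, hx, hy⟩ := h1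
  have hlt : ∀ x : Fin K, gray _ x.val z = false → x < v := fun x hx => by
    have := hdec _ hx
    rwa [ofNat_grayInv_gray] at this
  refine Or.inl ⟨⟨hr, hX, hlt _ hx, fun A hA => ?_, fun A B hAB => ?_⟩,
    ⟨hY, fun w hw => hlt _ (hy w hw)⟩, Or.inr fun m buf t hpc hb => ?_⟩
  · simpa [PC.Holds, hA] using h2
  · simpa [PC.Holds, hAB] using h2
  -- Stored readings of the MSB are zero in a flash state, so a scan with only ones so far has no
  -- reading yet.
  · have hm : ¬ 0 < m := fun hm => h2 (by
      simp only [PC.Holds, hpc]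
      exact ⟨trivial, 0, hm, hb 0 hm⟩)
    have hm0 : m = 0 := by
      apply Fin.ext
      rw [Fin.lt_def] at hm
      simpa using hm
    subst hm0
    simp

variable [NeZero K]

theorem inv_step (hz : z.val = 0) (hg : gray _ v.val z = true)
    (hlow : ∀ x : Fin K, x < v → gray (width K) x.val z = false)
    (hdec : ∀ g : Fin (width K) → Bool, g z = false → Fin.ofNat K (grayInv _ g) < v)
    {s : Config n K} (h : ∀ i, Inv v z (decide (i = 0)) (s i) (s (i - 1)))
    (hf : ¬ Fires v (s 0)) (k : Fin n) (coin : Bool) (i : Fin n) :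
    Inv v z (decide (i = 0)) (step k coin s i) (step k coin s (i - 1)) := by
  have hf' : ∀ i : Fin n, decide (i = 0) = true → ¬ Fires v (s i) := fun i hi => by
    rw [of_decide_eq_true hi]; exact hf
  have hown : ∀ i, Inv v z (decide (i = 0))
      (own (decide (i = 0)) coin (s (i - 1)) (s i)) (s (i - 1)) := fun i =>
    (h i).own hz hg hlow hdec (h (i - 1)).below_or_high
      (fun hi hH => by
        obtain rfl := of_decide_eq_true hi
        exact all_high hz hg h hH 0) (hf' i)
  have hhigh : ∀ i, High v z (s i) → High v z (own (decide (i = 0)) coin (s (i - 1)) (s i)) :=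
    fun i hi => (h i).high_own hz (hf' i) hi
  have hpred : ∀ p, Inv v z (decide (i = 0)) p (s (i - 1)) → i - 1 ≠ k →
      Inv v z (decide (i = 0)) p (step k coin s (i - 1)) := fun p hp hne => by
    rw [step_apply_of_ne hne]
    split_ifs
    · exact hp.hear_pred _
    · exact hp
  by_cases hik : i = k
  · subst hik
    -- In a ring with one processor the same step acts on both arguments of the invariant;
    -- `hear_own_self` removes the spurious effect on its own reads.
    by_cases hi : i - 1 = i
    · have h1 := (hown i).hear (p := own (decide (i = 0)) coin (s (i - 1)) (s i)) hg
        (h (i - 1)).below_or_high (hown (i - 1)).below_or_high (hhigh (i - 1))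
      rw [hi, step_apply_self]
      simp only [hi] at h1 ⊢
      rwa [hear_own_self] at h1
    · rw [step_apply_self]
      exact hpred _ (hown i) hi
  · by_cases hi : i - 1 = k
    · subst hi
      rw [step_apply_self, step_apply_of_ne hik, if_pos (by rw [sub_add_cancel])]
      exact (h i).hear hg (h (i - 1)).below_or_high (hown (i - 1)).below_or_high (hhigh (i - 1))
    · rw [step_apply_of_ne hik, if_neg fun h' => hi (by rw [h', add_sub_cancel_right])]
      exact hpred _ (h i) hi

end Global

end GrayRing

theorem mainTheorem10 (n K : ℕ) [NeZero n] [NeZero K] (hK : 2 ≤ K)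
    (σ : ℕ → GrayRing.Config n K) (hσ : GrayRing.IsExecution σ)
    (hflash : GrayRing.IsFlash (σ 0)) :
    ∃ t : ℕ, GrayRing.IsHome (σ t) := by
  classical
  obtain ⟨sched, coin, hstep, hfair⟩ := hσ
  let z : Fin (GrayRing.width K) := ⟨0, GrayRing.width_pos hK⟩
  let v : Fin K := ⟨2 ^ (GrayRing.width K - 1), GrayRing.two_pow_width_pred_lt hK⟩
  have hz : z.val = 0 := rfl
  have hg : GrayRing.gray _ v.val z = true := GrayRing.gray_msb_two_pow z hz
  have hlow : ∀ x : Fin K, x < v → GrayRing.gray (GrayRing.width K) x.val z = false :=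
    fun x hx => GrayRing.gray_msb_eq_false z hz hx
  have hdec : ∀ g : Fin (GrayRing.width K) → Bool, g z = false →
      Fin.ofNat K (GrayRing.grayInv _ g) < v := fun g hgz =>
    (Nat.mod_le _ _).trans_lt (GrayRing.grayInv_lt_of_msb _ g z hz hgz)
  -- The invariant holds only up to the first firing, after which `p_0` leaves `v`; hence the use of
  -- `Nat.find`.
  have hex : ∃ t, GrayRing.Fires v (σ t 0) := GrayRing.exists_increment_from hstep hfair v
  have hinv : ∀ t, t ≤ Nat.find hex →
      ∀ i, GrayRing.Inv v z (decide (i = 0)) (σ t i) (σ t (i - 1)) := by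
    intro t
    induction t with
    | zero => exact fun _ => GrayRing.inv_of_isFlash hdec hz hflash
    | succ t ih =>
      intro ht i
      rw [hstep]
      exact GrayRing.inv_step hz hg hlow hdec (ih (by omega)) (Nat.find_min hex ht) _ _ i
  exact ⟨_, GrayRing.isHome_of_fires hz hg (hinv _ le_rfl) (Nat.find_spec hex)⟩
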